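/- Let $d,k,m$ be natural numbers, let $\ell_1,\dots,\ell_k\in\mathbb{Z}^d$ be distinct, and let $\Omega=\bigcup_{i=1}^k\big([-1/2,1/2]^d+\ell_i\big)$. Let $PW_\Omega$ be the space of all $f\in L^2(\mathbb{R}^d)$ (complex-valued) whose Fourier transform $\hat f$, normalized by $\hat f(\omega)=\int_{\mathbb{R}^d} f(x)e^{-2\pi i\langle x,\omega\rangle}\,dx$ and extended to $L^2(\mathbb{R}^d)$, is supported in $\Omega$. Every $f\in PW_\Omega$ has a unique continuous representative; let $f(x)$ denote the value of that representative at $x$. Let $x_1,\dots,x_m$ be independent random variables uniformly distributed in $[-1/2,1/2]^d$, let $\varepsilon>0$ and $0<\alpha<1$. If $$m\ \ge\ \frac{10}{\alpha^2}\, k\,\log\left(\frac{2k}{\varepsilon}\right),$$ then with probability at least $1-\varepsilon$, the sampling inequalities $$m(1-\alpha)\|f\|_2^2\ \le\ \sum_{r=1}^m\sum_{\ell\in\mathbb{Z}^d}|f(x_r+\ell)|^2\ \le\ m(1+\alpha)\|f\|_2^2$$ hold simultaneously for all $f\in PW_\Omega$. (For $k=0$ the right-hand side of the condition on $m$ is read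 as $0$.) -/

import Mathlib

open MeasureTheory ProbabilityTheory
open scoped FourierTransform

noncomputable section

/-- The integer vector `n` as a point of Euclidean space. -/
def intPoint {d : ℕ} (n : Fin d → ℤ) : EuclideanSpace ℝ (Fin d) :=
  WithLp.toLp 2 (fun i => (n i : ℝ))

/-- The closed unit cube `[-1/2, 1/2]^d`. -/
def unitCube (d : ℕ) : Set (EuclideanSpace ℝ (Fin d)) :=
  {x | ∀ i, x i ∈ Set.Icc (-(1 / 2) : ℝ) (1 / 2)}

/-- The union of the translates `[-1/2, 1/2]^d + ℓ i`. -/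
def cubeUnion {d k : ℕ} (ℓ : Fin k → Fin d → ℤ) : Set (EuclideanSpace ℝ (Fin d)) :=
  ⋃ i, (fun y => y + intPoint (ℓ i)) '' unitCube d

/-- The Paley-Wiener space of a compact set `Ω`: the elements of `L²(ℝ^d)` whose
Fourier-Plancherel transform is supported in `Ω`. As `Ω` is closed, the (essential) support
is contained in `Ω` exactly when the transform vanishes almost everywhere outside `Ω`. -/
def paleyWiener {d : ℕ} (Ω : Set (EuclideanSpace ℝ (Fin d))) :
    Set (Lp ℂ 2 (volume : Measure (EuclideanSpace ℝ (Fin d)))) :=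
  {f | ∀ᵐ ω : EuclideanSpace ℝ (Fin d), ω ∉ Ω →
    (𝓕 f : Lp ℂ 2 (volume : Measure (EuclideanSpace ℝ (Fin d)))) ω = 0}

/-- `g` is a continuous representative of the `L²` class `f`. -/
def IsContRep {d : ℕ} (f : Lp ℂ 2 (volume : Measure (EuclideanSpace ℝ (Fin d))))
    (g : EuclideanSpace ℝ (Fin d) → ℂ) : Prop :=
  Continuous g ∧ g =ᵐ[volume] f

end

/-!
Write `h` for the Fourier transform of `f ∈ PW_Ω` and cut it along the cubes of `Ω`: put
`v ω = (h (ω + ℓ i))_i` for `ω` in the unit cube `Q`. Then `‖f‖² = ∫_Q ‖v ω‖²`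
(`norm_sq_eq_integral_of_mem_paleyWiener`). Since `⟨ℓ i, n⟩` is an integer, the samples of `f` on
`x + ℤ^d` are the Fourier coefficients on `Q` of a function of modulus `|∑ i, c i (x) * v ω i|`,
where `c i (x) = exp (2πi ⟨x, ℓ i⟩)`, so Parseval's identity on the torus gives
`∑ n, |f (x + n)|² = ∫_Q |∑ i, c i (x) * v ω i|² dω` (`hasSum_norm_sq_of_isContRep`). All sampling
inequalities therefore hold as soon as the Hermitian `k × k` matrix `S = ∑ r, Y (x_r)`, with
`Y (x) = (conj (c i (x)) * c j (x))_{ij} - 1` (`sampleMatrix`), has spectral norm at most `α m`.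

The matrices `Y (x_r)` are independent, are centered because the `ℓ i` are distinct, and satisfy
`Y² = (k - 2) Y + (k - 1)`. The norm of `S` is bounded by the moment method. Replacing one summand
by an independent copy yields an exchangeable pair `(S, S')`, and the trace inequality
`tr (A - B) (Aⁿ - Bⁿ) ≤ n / 2 * tr (A - B)² (Aⁿ⁻¹ + Bⁿ⁻¹)` for odd `n`
(`trace_sub_mul_pow_sub_pow_le`), which is an inequality between real numbers in eigenbases of `A`
and `B`, bounds `E tr Sⁿ⁺¹` by `n / 2 * ((k - 2) E tr Sⁿ + 2 m (k - 1) E tr Sⁿ⁻¹)`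
(`integral_trace_even_pow_succ_le`). The odd moment is absorbed by its neighbours, which leaves
`E tr S²ᵖ ≤ k * (45 / 32 * m k p)ᵖ`, and Markov's inequality with `p = ⌈log (2k / ε)⌉` bounds the
probability that the norm exceeds `α m` by `ε` (`exists_measure_trace_pow_gt_le`).

The continuous representative of `f` is the inverse Fourier integral of `h`, which is integrable
because `Ω` has finite measure; it agrees with the `L²` function `f` because both define the same
tempered distribution (`fourierInv_fourier_ae_eq`).
-/

noncomputable section

/-! ### Traces of products of powers of Hermitian matrices -/

section Trace

variable {n : Type*} [Fintype n] [DecidableEq n]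

lemma Matrix.IsHermitian.exists_pow_eq_mul_diagonal_mul {A : Matrix n n ℂ} (hA : A.IsHermitian) :
    ∃ (U : Matrix n n ℂ) (a : n → ℝ), U.conjTranspose * U = 1 ∧ U * U.conjTranspose = 1 ∧
      ∀ p : ℕ, A ^ p = U * Matrix.diagonal (fun i => ((a i : ℂ)) ^ p) * U.conjTranspose := by
  obtain ⟨U, hU⟩ : ∃ U : Matrix n n ℂ, U = hA.eigenvectorUnitary.1 := ⟨_, rfl⟩
  have h1 : U.conjTranspose * U = 1 := by
    rw [hU]; exact Unitary.coe_star_mul_self hA.eigenvectorUnitary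
  have h2 : U * U.conjTranspose = 1 := by
    rw [hU]; exact Unitary.coe_mul_star_self hA.eigenvectorUnitary
  refine ⟨U, hA.eigenvalues, h1, h2, fun p => ?_⟩
  have hs : A = U * Matrix.diagonal (fun i => (hA.eigenvalues i : ℂ)) * U.conjTranspose := by
    have := hA.spectral_theorem
    rw [Unitary.conjStarAlgAut_apply] at this
    rw [hU]
    exact this
  induction p with
  | zero => simp [h2]
  | succ p ih =>
    rw [pow_succ, ih]
    nth_rewrite 2 [hs]
    calc _ = U * Matrix.diagonal (fun i => (hA.eigenvalues i : ℂ) ^ p) *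
          (U.conjTranspose * U) * Matrix.diagonal (fun i => (hA.eigenvalues i : ℂ)) *
            U.conjTranspose := by simp only [Matrix.mul_assoc]
      _ = _ := by
        rw [h1, Matrix.mul_one, Matrix.mul_assoc U, Matrix.diagonal_mul_diagonal]
        simp only [pow_succ]

/-- The numbers `w i j` are the squared moduli of the inner products of the vectors in
eigenbases of `A` and `B`; they reduce trace inequalities between polynomials in which powers
of `A` stand to the left of powers of `B` to inequalities between real numbers. -/
lemma exists_trace_pow_mul_pow {A B : Matrix n n ℂ} (hA : A.IsHermitian) (hB : B.IsHermitian) :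
    ∃ (a b : n → ℝ) (w : n → n → ℝ), (∀ i j, 0 ≤ w i j) ∧
      ∀ p q : ℕ, (A ^ p * B ^ q).trace = ((∑ i, ∑ j, a i ^ p * b j ^ q * w i j : ℝ) : ℂ) := by
  obtain ⟨U, a, -, -, ha⟩ := hA.exists_pow_eq_mul_diagonal_mul
  obtain ⟨V, b, -, -, hb⟩ := hB.exists_pow_eq_mul_diagonal_mul
  refine ⟨a, b, fun i j => Complex.normSq ((U.conjTranspose * V) i j),
    fun i j => Complex.normSq_nonneg _, fun p q => ?_⟩
  set W := U.conjTranspose * V with hW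
  have hW' : W.conjTranspose = V.conjTranspose * U := by simp [hW]
  have : (A ^ p * B ^ q).trace = (Matrix.diagonal (fun i => (a i : ℂ) ^ p) * W *
      (Matrix.diagonal (fun i => (b i : ℂ) ^ q) * W.conjTranspose)).trace := by
    rw [ha, hb, hW', hW, Matrix.mul_assoc U, Matrix.mul_assoc U, Matrix.trace_mul_comm]
    simp only [Matrix.mul_assoc]
  rw [this]
  simp only [Matrix.trace, Matrix.diag, Matrix.mul_apply (M := Matrix.diagonal _ * W),
    Matrix.diagonal_mul, Matrix.conjTranspose_apply]
  push_cast
  refine Finset.sum_congr rfl fun i _ => Finset.sum_congr rfl fun j _ => ?_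
  rw [← Complex.mul_conj, ← starRingEnd_apply]
  ring

lemma exists_trace_pow {A : Matrix n n ℂ} (hA : A.IsHermitian) :
    ∃ a : n → ℝ, ∀ p : ℕ, (A ^ p).trace = ((∑ i, a i ^ p : ℝ) : ℂ) := by
  obtain ⟨U, a, h1, -, ha⟩ := hA.exists_pow_eq_mul_diagonal_mul
  refine ⟨a, fun p => ?_⟩
  rw [ha, Matrix.mul_assoc, Matrix.trace_mul_comm, Matrix.mul_assoc, h1, Matrix.mul_one,
    Matrix.trace_diagonal]
  push_cast
  rfl

lemma pow_mul_pow_add_pow_mul_pow_le {x y : ℝ} (hx : 0 ≤ x) (hy : 0 ≤ y) (i j : ℕ) :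
    x ^ i * y ^ j + x ^ j * y ^ i ≤ x ^ (i + j) + y ^ (i + j) := by
  have : 0 ≤ (x ^ i - y ^ i) * (x ^ j - y ^ j) := by
    rcases le_total x y with h | h
    · exact mul_nonneg_of_nonpos_of_nonpos (sub_nonpos.2 (pow_le_pow_left₀ hx h i))
        (sub_nonpos.2 (pow_le_pow_left₀ hx h j))
    · exact mul_nonneg (sub_nonneg.2 (pow_le_pow_left₀ hy h i))
        (sub_nonneg.2 (pow_le_pow_left₀ hy h j))
  rw [pow_add, pow_add]
  linarith

/-- Trapezoidal bound for the difference quotient of an odd power. -/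
lemma sub_mul_pow_sub_pow_le (x y : ℝ) (k : ℕ) :
    (x - y) * (x ^ (2 * k + 1) - y ^ (2 * k + 1)) ≤
      (2 * k + 1) / 2 * ((x - y) ^ 2 * (x ^ (2 * k) + y ^ (2 * k))) := by
  have hgeom := (Commute.all x y).mul_geom_sum₂ (2 * k + 1)
  set T := ∑ i ∈ Finset.range (2 * k + 1), x ^ i * y ^ (2 * k + 1 - 1 - i) with hT
  have hrefl : ∑ i ∈ Finset.range (2 * k + 1), |x| ^ i * |y| ^ (2 * k - i) =
      ∑ i ∈ Finset.range (2 * k + 1), |x| ^ (2 * k - i) * |y| ^ i := by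
    rw [← Finset.sum_range_reflect]
    refine Finset.sum_congr rfl fun i hi => ?_
    have := Finset.mem_range.1 hi
    rw [show 2 * k + 1 - 1 - i = 2 * k - i by omega, show 2 * k - (2 * k - i) = i by omega]
  have hTle : T ≤ ∑ i ∈ Finset.range (2 * k + 1), |x| ^ i * |y| ^ (2 * k - i) := by
    refine Finset.sum_le_sum fun i _ => ?_
    rw [← abs_pow, ← abs_pow, ← abs_mul]
    exact le_abs_self _
  have h2 : ∑ i ∈ Finset.range (2 * k + 1), |x| ^ i * |y| ^ (2 * k - i) +
      ∑ i ∈ Finset.range (2 * k + 1), |x| ^ (2 * k - i) * |y| ^ i ≤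
      (2 * k + 1) * (x ^ (2 * k) + y ^ (2 * k)) := by
    rw [← Finset.sum_add_distrib]
    have : ∀ i ∈ Finset.range (2 * k + 1), |x| ^ i * |y| ^ (2 * k - i) +
        |x| ^ (2 * k - i) * |y| ^ i ≤ x ^ (2 * k) + y ^ (2 * k) := by
      intro i hi
      have hi' := Finset.mem_range.1 hi
      have := pow_mul_pow_add_pow_mul_pow_le (abs_nonneg x) (abs_nonneg y) i (2 * k - i)
      rwa [show i + (2 * k - i) = 2 * k by omega, (even_two_mul k).pow_abs,
        (even_two_mul k).pow_abs] at this
    refine (Finset.sum_le_sum this).trans_eq ?_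
    simp [mul_add]
  rw [← hgeom]
  have : T ≤ (2 * k + 1) / 2 * (x ^ (2 * k) + y ^ (2 * k)) := by linarith
  nlinarith [mul_le_mul_of_nonneg_left this (sq_nonneg (x - y))]

/-- The mean value trace inequality for an odd power. -/
lemma trace_sub_mul_pow_sub_pow_le {A B : Matrix n n ℂ} (hA : A.IsHermitian) (hB : B.IsHermitian)
    (k : ℕ) :
    ((A - B) * (A ^ (2 * k + 1) - B ^ (2 * k + 1))).trace.re ≤
      (2 * k + 1) / 2 * ((A - B) ^ 2 * (A ^ (2 * k) + B ^ (2 * k))).trace.re := by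
  obtain ⟨a, b, w, hw, h⟩ := exists_trace_pow_mul_pow hA hB
  have hl : ((A - B) * (A ^ (2 * k + 1) - B ^ (2 * k + 1))).trace =
      (A ^ (2 * k + 2) * B ^ 0).trace - (A ^ 1 * B ^ (2 * k + 1)).trace
      - (A ^ (2 * k + 1) * B ^ 1).trace + (A ^ 0 * B ^ (2 * k + 2)).trace := by
    rw [Matrix.sub_mul, Matrix.mul_sub, Matrix.mul_sub]
    simp only [Matrix.trace_sub, Matrix.trace_mul_comm B (A ^ _), pow_zero, Matrix.mul_one,
      Matrix.one_mul, pow_one, ← pow_succ', show 2 * k + 1 + 1 = 2 * k + 2 from rfl]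
    ring
  have hr : ((A - B) ^ 2 * (A ^ (2 * k) + B ^ (2 * k))).trace =
      (A ^ (2 * k + 2) * B ^ 0).trace - 2 * (A ^ (2 * k + 1) * B ^ 1).trace
      + (A ^ (2 * k) * B ^ 2).trace + (A ^ 2 * B ^ (2 * k)).trace
      - 2 * (A ^ 1 * B ^ (2 * k + 1)).trace + (A ^ 0 * B ^ (2 * k + 2)).trace := by
    have e1 : (A * B * A ^ (2 * k)).trace = (A ^ (2 * k + 1) * B ^ 1).trace := by
      rw [Matrix.trace_mul_comm, ← Matrix.mul_assoc, ← pow_succ, pow_one]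
    have e2 : (B * A * A ^ (2 * k)).trace = (A ^ (2 * k + 1) * B ^ 1).trace := by
      rw [Matrix.mul_assoc, Matrix.trace_mul_comm, ← pow_succ', pow_one]
    have e3 : (A * B * B ^ (2 * k)).trace = (A ^ 1 * B ^ (2 * k + 1)).trace := by
      rw [Matrix.mul_assoc, ← pow_succ', pow_one]
    have e4 : (B * A * B ^ (2 * k)).trace = (A ^ 1 * B ^ (2 * k + 1)).trace := by
      rw [Matrix.mul_assoc, Matrix.trace_mul_comm, Matrix.mul_assoc, ← pow_succ, pow_one]
    have e5 : (A * A * A ^ (2 * k)).trace = (A ^ (2 * k + 2) * B ^ 0).trace := by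
      rw [pow_zero, Matrix.mul_one, ← pow_two, ← pow_add, add_comm]
    have e6 : (B * B * B ^ (2 * k)).trace = (A ^ 0 * B ^ (2 * k + 2)).trace := by
      rw [pow_zero, Matrix.one_mul, ← pow_two, ← pow_add, add_comm]
    have e7 : (B * B * A ^ (2 * k)).trace = (A ^ (2 * k) * B ^ 2).trace := by
      rw [Matrix.trace_mul_comm, ← pow_two]
    have e8 : (A * A * B ^ (2 * k)).trace = (A ^ 2 * B ^ (2 * k)).trace := by
      rw [← pow_two]
    rw [pow_two (A - B)]
    simp only [Matrix.sub_mul, Matrix.mul_sub, Matrix.mul_add, Matrix.trace_sub,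
      Matrix.trace_add, e1, e2, e3, e4, e5, e6, e7, e8]
    ring
  rw [hl, hr]
  simp only [h]
  norm_cast
  simp only [Finset.mul_sum, ← Finset.sum_sub_distrib, ← Finset.sum_add_distrib]
  refine Finset.sum_le_sum fun i _ => Finset.sum_le_sum fun j _ => ?_
  have := mul_le_mul_of_nonneg_right (sub_mul_pow_sub_pow_le (a i) (b j) k) (hw i j)
  calc _ = (a i - b j) * (a i ^ (2 * k + 1) - b j ^ (2 * k + 1)) * w i j := by ring
    _ ≤ _ := this
    _ = _ := by push_cast; ring

lemma trace_even_pow_nonneg {A : Matrix n n ℂ} (hA : A.IsHermitian) (k : ℕ) :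
    0 ≤ (A ^ (2 * k)).trace.re := by
  obtain ⟨a, ha⟩ := exists_trace_pow hA
  rw [ha, Complex.ofReal_re]
  exact Finset.sum_nonneg fun i _ => (even_two_mul k).pow_nonneg _

/-- The odd trace moments are controlled by the two neighbouring even ones. -/
lemma abs_trace_odd_pow_le {A : Matrix n n ℂ} (hA : A.IsHermitian) (k : ℕ) {c : ℝ} (hc : 0 < c) :
    |(A ^ (2 * k + 1)).trace.re| ≤
      (c⁻¹ * (A ^ (2 * k + 2)).trace.re + c * (A ^ (2 * k)).trace.re) / 2 := by
  obtain ⟨a, ha⟩ := exists_trace_pow hA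
  simp only [ha, Complex.ofReal_re]
  rw [Finset.mul_sum, Finset.mul_sum, ← Finset.sum_add_distrib, Finset.sum_div]
  refine (Finset.abs_sum_le_sum_abs _ _).trans (Finset.sum_le_sum fun i _ => ?_)
  have h0 : 0 ≤ a i ^ (2 * k) := (even_two_mul k).pow_nonneg _
  rw [pow_succ, abs_mul, abs_of_nonneg h0, pow_add, ← sq_abs (a i)]
  have : |a i| ≤ (c⁻¹ * |a i| ^ 2 + c) / 2 := by
    have e : (c⁻¹ * |a i| ^ 2 + c) / 2 - |a i| = c⁻¹ * (|a i| - c) ^ 2 / 2 := by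
      field_simp; ring
    have : 0 ≤ c⁻¹ * (|a i| - c) ^ 2 / 2 := by positivity
    linarith
  calc _ ≤ a i ^ (2 * k) * ((c⁻¹ * |a i| ^ 2 + c) / 2) := mul_le_mul_of_nonneg_left this h0
    _ = _ := by rw [sq_abs, ← sq_abs]; ring

/-- An even trace moment dominates the corresponding power of every eigenvalue, hence of the
quadratic form on unit vectors. -/
lemma abs_re_dotProduct_mulVec_le {A : Matrix n n ℂ} (hA : A.IsHermitian) {p : ℕ} (hp : p ≠ 0)
    {t : ℝ} (ht : 0 ≤ t) (h : (A ^ (2 * p)).trace.re ≤ t ^ (2 * p)) (v : n → ℂ) :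
    |(star v ⬝ᵥ A.mulVec v).re| ≤ t * ∑ i, ‖v i‖ ^ 2 := by
  obtain ⟨U, a, h1, h2, ha⟩ := hA.exists_pow_eq_mul_diagonal_mul
  have htr : (A ^ (2 * p)).trace.re = ∑ i, a i ^ (2 * p) := by
    rw [ha, Matrix.mul_assoc, Matrix.trace_mul_comm, Matrix.mul_assoc, h1, Matrix.mul_one,
      Matrix.trace_diagonal]
    norm_cast
  have hat : ∀ i, |a i| ≤ t := by
    intro i
    refine le_of_pow_le_pow_left₀ (n := 2 * p) (by omega) ht ?_
    rw [(even_two_mul p).pow_abs]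
    exact (Finset.single_le_sum (f := fun i => a i ^ (2 * p))
      (fun i _ => (even_two_mul p).pow_nonneg _) (Finset.mem_univ i)).trans (htr ▸ h)
  set u := U.conjTranspose.mulVec v with hu
  have hnorm : ∑ i, ‖v i‖ ^ 2 = ∑ i, ‖u i‖ ^ 2 := by
    have : star u ⬝ᵥ u = star v ⬝ᵥ v := by
      rw [hu, Matrix.star_mulVec, Matrix.conjTranspose_conjTranspose,
        ← Matrix.dotProduct_mulVec, Matrix.mulVec_mulVec, h2, Matrix.one_mulVec]
    have e : ∀ z : n → ℂ, star z ⬝ᵥ z = ((∑ i, ‖z i‖ ^ 2 : ℝ) : ℂ) := by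
      intro z
      simp only [dotProduct, Pi.star_apply, RCLike.star_def]
      push_cast
      exact Finset.sum_congr rfl fun i _ => Complex.conj_mul' _
    rw [e, e] at this
    exact_mod_cast this.symm
  have hquad : star v ⬝ᵥ A.mulVec v = ((∑ i, a i * ‖u i‖ ^ 2 : ℝ) : ℂ) := by
    have hA1 := ha 1
    simp only [pow_one] at hA1
    have hsu : star u = Matrix.vecMul (star v) U := by
      rw [hu, Matrix.star_mulVec, Matrix.conjTranspose_conjTranspose]
    rw [hA1, ← Matrix.mulVec_mulVec, ← Matrix.mulVec_mulVec, Matrix.dotProduct_mulVec,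
      ← hsu, ← hu]
    simp only [dotProduct, Pi.star_apply, RCLike.star_def, Matrix.mulVec_diagonal]
    push_cast
    refine Finset.sum_congr rfl fun i _ => ?_
    rw [← Complex.conj_mul']
    ring
  rw [hquad, Complex.ofReal_re, hnorm, Finset.mul_sum]
  refine (Finset.abs_sum_le_sum_abs _ _).trans (Finset.sum_le_sum fun i _ => ?_)
  rw [abs_mul, abs_of_nonneg (sq_nonneg ‖u i‖)]
  exact mul_le_mul_of_nonneg_right (hat i) (sq_nonneg _)

end Trace

/-! ### Moments of sums of independent random matrices -/

section Moments

variable {n : Type*} {X Ω : Type*} [MeasurableSpace X] [MeasurableSpace Ω]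

/-- A matrix-valued function whose entries are measurable and bounded. -/
def IsBddMeas (F : Ω → Matrix n n ℂ) : Prop :=
  ∀ i j, Measurable (fun x => F x i j) ∧ ∃ C : ℝ, ∀ x, ‖F x i j‖ ≤ C

namespace IsBddMeas

variable {F G : Ω → Matrix n n ℂ}

lemma const (A : Matrix n n ℂ) : IsBddMeas (fun _ : Ω => A) :=
  fun i j => ⟨measurable_const, ‖A i j‖, fun _ => le_rfl⟩

lemma comp {F : X → Matrix n n ℂ} (hF : IsBddMeas F) {g : Ω → X} (hg : Measurable g) :
    IsBddMeas (fun x => F (g x)) :=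
  fun i j => ⟨(hF i j).1.comp hg, (hF i j).2.imp fun _ h _ => h _⟩

lemma add (hF : IsBddMeas F) (hG : IsBddMeas G) : IsBddMeas (fun x => F x + G x) := by
  intro i j
  obtain ⟨h1, C, hC⟩ := hF i j
  obtain ⟨h2, D, hD⟩ := hG i j
  exact ⟨h1.add h2, C + D, fun x => (norm_add_le _ _).trans (add_le_add (hC x) (hD x))⟩

lemma sub (hF : IsBddMeas F) (hG : IsBddMeas G) : IsBddMeas (fun x => F x - G x) := by
  intro i j
  obtain ⟨h1, C, hC⟩ := hF i j
  obtain ⟨h2, D, hD⟩ := hG i j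
  exact ⟨h1.sub h2, C + D, fun x => (norm_sub_le _ _).trans (add_le_add (hC x) (hD x))⟩

lemma sum {ι : Type*} {s : Finset ι} {F : ι → Ω → Matrix n n ℂ} (hF : ∀ r, IsBddMeas (F r)) :
    IsBddMeas (fun x => ∑ r ∈ s, F r x) := by
  classical
  induction s using Finset.induction_on with
  | empty => simpa using const (Ω := Ω) (0 : Matrix n n ℂ)
  | insert r s hr ih => simpa only [Finset.sum_insert hr] using (hF r).add ih

lemma integrable_apply {P : Measure Ω} [IsFiniteMeasure P] (hF : IsBddMeas F) (i j : n) :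
    Integrable (fun x => F x i j) P := by
  obtain ⟨h, C, hC⟩ := hF i j
  exact .of_bound h.aestronglyMeasurable C (.of_forall hC)

variable [Fintype n]

lemma mul (hF : IsBddMeas F) (hG : IsBddMeas G) : IsBddMeas (fun x => F x * G x) := by
  intro i j
  choose hFm C hC using hF
  choose hGm D hD using hG
  refine ⟨?_, ∑ l, C i l * D l j, fun x => ?_⟩
  · simp only [Matrix.mul_apply]
    exact Finset.measurable_sum _ fun l _ => (hFm i l).mul (hGm l j)
  · change ‖(F x * G x) i j‖ ≤ _
    rw [Matrix.mul_apply]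
    refine (norm_sum_le _ _).trans (Finset.sum_le_sum fun l _ => ?_)
    rw [norm_mul]
    exact mul_le_mul (hC i l x) (hD l j x) (norm_nonneg _) ((norm_nonneg _).trans (hC i l x))

lemma measurable_trace (hF : IsBddMeas F) : Measurable (fun x => (F x).trace) := by
  simp only [Matrix.trace, Matrix.diag]
  exact Finset.measurable_sum _ fun l _ => (hF l l).1

lemma integrable_trace {P : Measure Ω} [IsFiniteMeasure P] (hF : IsBddMeas F) :
    Integrable (fun x => (F x).trace) P := by
  simp only [Matrix.trace, Matrix.diag]
  exact integrable_finsetSum _ fun i _ => hF.integrable_apply i i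

lemma pow [DecidableEq n] (hF : IsBddMeas F) (p : ℕ) : IsBddMeas (fun x => F x ^ p) := by
  induction p with
  | zero => simpa using const (Ω := Ω) (1 : Matrix n n ℂ)
  | succ p ih => simpa only [pow_succ] using ih.mul hF

end IsBddMeas

variable [Fintype n] {μ : Measure X} [IsProbabilityMeasure μ] {m : ℕ}

lemma integral_pi_swap {E : Type*} [NormedAddCommGroup E] [NormedSpace ℝ E] (a b : Fin m)
    (F : (Fin m → X) → E) :
    ∫ x, F (fun r => x (Equiv.swap a b r)) ∂(Measure.pi fun _ => μ) =
      ∫ x, F x ∂(Measure.pi fun _ => μ) := by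
  have h := measurePreserving_piCongrLeft (fun _ : Fin m => μ) (Equiv.swap a b)
  rw [← h.integral_comp (MeasurableEquiv.measurableEmbedding _)]
  refine integral_congr_ae (.of_forall fun x => ?_)
  exact congrArg F (funext fun r =>
    MeasurableEquiv.piCongrLeft_apply_apply (β := fun _ => X) (Equiv.swap a b) x r)

lemma measurePreserving_pi_castSucc :
    MeasurePreserving (fun (x : Fin (m + 1) → X) (r : Fin m) => x r.castSucc)
      (Measure.pi fun _ => μ) (Measure.pi fun _ => μ) := by
  have h := (measurePreserving_snd (μ := μ) (ν := Measure.pi fun _ : Fin m => μ)).comp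
    (measurePreserving_piFinSuccAbove (fun _ : Fin (m + 1) => μ) (Fin.last m))
  convert h using 1
  ext x r
  simp [MeasurableEquiv.piFinSuccAbove, Fin.init]

lemma integral_pi_castSucc {E : Type*} [NormedAddCommGroup E] [NormedSpace ℝ E]
    {F : (Fin m → X) → E} (hF : AEStronglyMeasurable F (Measure.pi fun _ => μ)) :
    ∫ x, F (fun r => x r.castSucc) ∂(Measure.pi fun _ : Fin (m + 1) => μ) =
      ∫ x, F x ∂(Measure.pi fun _ => μ) := by
  have h := measurePreserving_pi_castSucc (μ := μ) (m := m)
  rw [← h.map_eq] at hF ⊢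
  rw [integral_map h.measurable.aemeasurable hF]

lemma integral_trace_mul_eq_zero {Y : X → Matrix n n ℂ} (hY : IsBddMeas Y)
    (hY0 : ∀ i j, ∫ y, Y y i j ∂μ = 0) {G : (Fin m → X) → Matrix n n ℂ} (hG : IsBddMeas G) :
    ∫ x, (Y (x (Fin.last m)) * G (fun r => x r.castSucc)).trace
      ∂(Measure.pi fun _ : Fin (m + 1) => μ) = 0 := by
  have h := measurePreserving_piFinSuccAbove (fun _ : Fin (m + 1) => μ) (Fin.last m)
  have e : ∀ x : Fin (m + 1) → X, (Y (x (Fin.last m)) * G (fun r => x r.castSucc)).trace =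
      (fun z : X × (Fin m → X) => (Y z.1 * G z.2).trace)
        (MeasurableEquiv.piFinSuccAbove (fun _ => X) (Fin.last m) x) := by
    intro x
    have : (fun r : Fin m => x r.castSucc) =
        (MeasurableEquiv.piFinSuccAbove (fun _ => X) (Fin.last m) x).2 := by
      ext r
      simp [MeasurableEquiv.piFinSuccAbove, Fin.init]
    rw [this]
    rfl
  simp only [e]
  rw [h.integral_comp (MeasurableEquiv.measurableEmbedding _)
    (fun z : X × (Fin m → X) => (Y z.1 * G z.2).trace)]
  simp only [Matrix.trace, Matrix.diag, Matrix.mul_apply]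
  have hint : ∀ i j, Integrable (fun z : X × (Fin m → X) => Y z.1 i j * G z.2 j i)
      (μ.prod (Measure.pi fun _ => μ)) := fun i j =>
    (hY.integrable_apply i j).mul_prod (hG.integrable_apply j i)
  rw [integral_finsetSum _ fun i _ => integrable_finsetSum _ fun j _ => hint i j]
  refine Finset.sum_eq_zero fun i _ => ?_
  rw [integral_finsetSum _ fun j _ => hint i j]
  refine Finset.sum_eq_zero fun j _ => ?_
  rw [integral_prod_mul (fun y => Y y i j) (fun z => G z j i), hY0, zero_mul]

end Moments

section MomentRecursion

variable {n : Type*} [Fintype n] [DecidableEq n] {X Ω : Type*} [MeasurableSpace X]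
  [MeasurableSpace Ω]

/-- The pair `(S, S ∘ τ)` is exchangeable, and `S - S ∘ τ = Z - Z'`, where `Z'` is independent of
`S` and `Z` as far as the moments at hand are concerned. The mean value trace inequality bounds
the moment `tr (Z * S ^ (2 * k + 1))`. -/
lemma integral_trace_mul_odd_pow_le_of_exchangeable {P : Measure Ω} [IsFiniteMeasure P]
    {S Z Z' : Ω → Matrix n n ℂ} {τ : Ω → Ω} (hτ : Measurable τ)
    (hswap : ∀ F : Ω → ℂ, ∫ x, F (τ x) ∂P = ∫ x, F x ∂P) (hττ : ∀ x, τ (τ x) = x)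
    (hS : IsBddMeas S) (hZ : IsBddMeas Z) (hZ' : IsBddMeas Z') (hSh : ∀ x, (S x).IsHermitian)
    (hZτ : ∀ x, Z (τ x) = Z' x) (hdiff : ∀ x, S x - S (τ x) = Z x - Z' x)
    (h0 : ∀ p, ∫ x, (Z' x * S x ^ p).trace ∂P = 0)
    (h0r : ∀ p, ∫ x, (Z' x * (S x ^ p * Z x)).trace ∂P = 0)
    (h0l : ∀ p, ∫ x, (Z' x * (Z x * S x ^ p)).trace ∂P = 0) {a b : ℝ}
    (hZsq : ∀ x, Z x ^ 2 = (a : ℂ) • Z x + (b : ℂ) • 1)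
    (hZsq' : ∀ x, Z' x ^ 2 = (a : ℂ) • Z' x + (b : ℂ) • 1) (k : ℕ) :
    ∫ x, (Z x * S x ^ (2 * k + 1)).trace.re ∂P ≤
      (2 * k + 1) / 2 * (a * ∫ x, (Z x * S x ^ (2 * k)).trace.re ∂P +
        2 * b * ∫ x, (S x ^ (2 * k)).trace.re ∂P) := by
  have hZτ' : ∀ x, Z' (τ x) = Z x := fun x => by rw [← hZτ, hττ]
  have hSt : IsBddMeas fun x => S (τ x) := hS.comp hτ
  -- symmetrization
  have h2 : ∫ x, (Z x * S (τ x) ^ (2 * k + 1)).trace ∂P = 0 := by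
    rw [← h0 (2 * k + 1), ← hswap]
    simp only [hττ, hZτ]
  have h3 : ∫ x, (Z' x * S (τ x) ^ (2 * k + 1)).trace ∂P =
      ∫ x, (Z x * S x ^ (2 * k + 1)).trace ∂P := by
    rw [← hswap]
    simp only [hττ, hZτ']
  have h4 : ∫ x, ((S x - S (τ x)) *
      (S x ^ (2 * k + 1) - S (τ x) ^ (2 * k + 1))).trace ∂P =
      2 * ∫ x, (Z x * S x ^ (2 * k + 1)).trace ∂P := by
    have i1 := (hZ.mul (hS.pow (2 * k + 1))).integrable_trace (P := P)
    have i2 := (hZ'.mul (hS.pow (2 * k + 1))).integrable_trace (P := P)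
    have i3 := (hZ.mul (hSt.pow (2 * k + 1))).integrable_trace (P := P)
    have i4 := (hZ'.mul (hSt.pow (2 * k + 1))).integrable_trace (P := P)
    simp only [hdiff, Matrix.sub_mul, Matrix.mul_sub, Matrix.trace_sub]
    rw [integral_sub (by exact i1.sub i2) (by exact i3.sub i4), integral_sub i1 i2,
      integral_sub i3 i4, h0, h2, h3]
    ring
  have hD : IsBddMeas fun x => (Z x - Z' x) ^ 2 := (hZ.sub hZ').pow 2
  have h5 : ∫ x, ((S x - S (τ x)) ^ 2 * (S x ^ (2 * k) + S (τ x) ^ (2 * k))).trace ∂P =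
      2 * ∫ x, ((Z x - Z' x) ^ 2 * S x ^ (2 * k)).trace ∂P := by
    simp only [hdiff, Matrix.mul_add, Matrix.trace_add]
    have e : ∫ x, ((Z x - Z' x) ^ 2 * S (τ x) ^ (2 * k)).trace ∂P =
        ∫ x, ((Z x - Z' x) ^ 2 * S x ^ (2 * k)).trace ∂P := by
      rw [← hswap]
      refine integral_congr_ae (.of_forall fun x => ?_)
      simp only [hττ, hZτ, hZτ']
      rw [← neg_sub (Z x), neg_sq]
    rw [integral_add (hD.mul (hS.pow _)).integrable_trace (hD.mul (hSt.pow _)).integrable_trace,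
      e]
    ring
  have h6 : ∫ x, ((Z x - Z' x) ^ 2 * S x ^ (2 * k)).trace ∂P =
      a * ∫ x, (Z x * S x ^ (2 * k)).trace ∂P + 2 * b * ∫ x, (S x ^ (2 * k)).trace ∂P := by
    have e : ∀ x, ((Z x - Z' x) ^ 2 * S x ^ (2 * k)).trace =
        a * (Z x * S x ^ (2 * k)).trace + a * (Z' x * S x ^ (2 * k)).trace +
        2 * b * (S x ^ (2 * k)).trace - (Z' x * (S x ^ (2 * k) * Z x)).trace -
        (Z' x * (Z x * S x ^ (2 * k))).trace := by
      intro x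
      have : (Z x - Z' x) ^ 2 = Z x ^ 2 + Z' x ^ 2 - Z x * Z' x - Z' x * Z x := by
        rw [pow_two, pow_two, pow_two, Matrix.sub_mul, Matrix.mul_sub, Matrix.mul_sub]
        abel
      rw [this, hZsq, hZsq', ← Matrix.mul_assoc, ← Matrix.mul_assoc,
        Matrix.trace_mul_comm _ (Z x), ← Matrix.mul_assoc]
      simp only [Matrix.sub_mul, Matrix.add_mul, Matrix.trace_sub, Matrix.trace_add,
        Matrix.smul_mul, Matrix.one_mul, Matrix.trace_smul, smul_eq_mul]
      ring
    have i1 := ((hZ.mul (hS.pow (2 * k))).integrable_trace (P := P)).const_mul (a : ℂ)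
    have i2 := ((hZ'.mul (hS.pow (2 * k))).integrable_trace (P := P)).const_mul (a : ℂ)
    have i3 := ((hS.pow (2 * k)).integrable_trace (P := P)).const_mul (2 * b : ℂ)
    have i4 := (hZ'.mul ((hS.pow (2 * k)).mul hZ)).integrable_trace (P := P)
    have i5 := (hZ'.mul (hZ.mul (hS.pow (2 * k)))).integrable_trace (P := P)
    simp only [e]
    rw [integral_sub (by exact ((i1.add i2).add i3).sub i4) i5,
      integral_sub (by exact (i1.add i2).add i3) i4,
      integral_add (by exact i1.add i2) i3, integral_add i1 i2, h0r, h0l, integral_const_mul,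
      integral_const_mul, integral_const_mul, h0]
    ring
  have hSd : IsBddMeas fun x => S x - S (τ x) := hS.sub hSt
  have hmean : ∫ x, ((S x - S (τ x)) *
      (S x ^ (2 * k + 1) - S (τ x) ^ (2 * k + 1))).trace.re ∂P ≤
      ∫ x, (2 * k + 1) / 2 * ((S x - S (τ x)) ^ 2 *
        (S x ^ (2 * k) + S (τ x) ^ (2 * k))).trace.re ∂P := by
    refine integral_mono ?_ ?_ fun x => trace_sub_mul_pow_sub_pow_le (hSh _) (hSh _) k
    · exact (hSd.mul ((hS.pow _).sub (hSt.pow _))).integrable_trace.re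
    · exact ((hSd.pow 2).mul ((hS.pow _).add (hSt.pow _))).integrable_trace.re.const_mul _
  rw [integral_const_mul] at hmean
  have re_eq : ∀ {F : Ω → Matrix n n ℂ}, IsBddMeas F →
      ∫ x, (F x).trace.re ∂P = (∫ x, (F x).trace ∂P).re :=
    fun hF => integral_re hF.integrable_trace
  rw [re_eq (hSd.mul ((hS.pow _).sub (hSt.pow _))),
    re_eq ((hSd.pow 2).mul ((hS.pow _).add (hSt.pow _))), h4, h5, h6] at hmean
  rw [re_eq (hZ.mul (hS.pow _)), re_eq (hZ.mul (hS.pow _)), re_eq (hS.pow _)]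
  have e1 : ∀ z w : ℂ, (2 * (a * z + 2 * b * w)).re = 2 * (a * z.re + 2 * b * w.re) := by
    intro z w; simp
  have e2 : ∀ z : ℂ, (2 * z).re = 2 * z.re := by intro z; simp
  rw [e1, e2] at hmean
  linarith

variable {μ : Measure X} [IsProbabilityMeasure μ] {m : ℕ}

/-- Moment recursion for a sum of independent copies of a centered Hermitian matrix `Y` with
`Y ^ 2 = a Y + b`. Replacing one summand by an additional independent copy gives an
exchangeable pair. -/
lemma integral_trace_even_pow_succ_le {Y : X → Matrix n n ℂ} (hY : IsBddMeas Y)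
    (hYh : ∀ y, (Y y).IsHermitian) (hY0 : ∀ i j, ∫ y, Y y i j ∂μ = 0) {a b : ℝ}
    (hYsq : ∀ y, Y y ^ 2 = (a : ℂ) • Y y + (b : ℂ) • 1) (k : ℕ) :
    ∫ x, ((∑ r, Y (x r)) ^ (2 * k + 2)).trace.re ∂(Measure.pi fun _ : Fin m => μ) ≤
      (2 * k + 1) / 2 *
        (a * ∫ x, ((∑ r, Y (x r)) ^ (2 * k + 1)).trace.re ∂(Measure.pi fun _ : Fin m => μ) +
          2 * m * b * ∫ x, ((∑ r, Y (x r)) ^ (2 * k)).trace.re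
            ∂(Measure.pi fun _ : Fin m => μ)) := by
  set P : Measure (Fin (m + 1) → X) := Measure.pi fun _ => μ with hP
  obtain ⟨S, hSdef⟩ : ∃ S : (Fin m → X) → Matrix n n ℂ, S = fun x => ∑ r, Y (x r) := ⟨_, rfl⟩
  have hSx : ∀ x, ∑ r, Y (x r) = S x := fun x => by rw [hSdef]
  simp only [hSx]
  have hinit : Measurable fun (x : Fin (m + 1) → X) (r : Fin m) => x r.castSucc :=
    measurable_pi_lambda _ fun r => measurable_pi_apply _
  have hS : IsBddMeas S := hSdef ▸ IsBddMeas.sum fun r => hY.comp (measurable_pi_apply r)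
  have hSh : ∀ x, (S x).IsHermitian := fun x => hSx x ▸
    isSelfAdjoint_sum _ fun r _ => (hYh (x r) : IsSelfAdjoint _)
  have hev : ∀ r : Fin (m + 1), IsBddMeas fun x : Fin (m + 1) → X => Y (x r) :=
    fun r => hY.comp (measurable_pi_apply r)
  have hSi : IsBddMeas fun x : Fin (m + 1) → X => S fun r => x r.castSucc := hS.comp hinit
  -- the contribution of one summand
  have key : ∀ r : Fin m,
      ∫ x, (Y (x r.castSucc) * (S fun r => x r.castSucc) ^ (2 * k + 1)).trace.re ∂P ≤
        (2 * k + 1) / 2 *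
          (a * ∫ x, (Y (x r.castSucc) * (S fun r => x r.castSucc) ^ (2 * k)).trace.re ∂P +
            2 * b * ∫ x, ((S fun r => x r.castSucc) ^ (2 * k)).trace.re ∂P) := by
    intro r
    have hYr : IsBddMeas fun x : Fin m → X => Y (x r) := hY.comp (measurable_pi_apply r)
    refine integral_trace_mul_odd_pow_le_of_exchangeable
      (S := fun x => S fun r => x r.castSucc)
      (Z := fun x => Y (x r.castSucc)) (Z' := fun x => Y (x (Fin.last m)))
      (τ := fun x i => x (Equiv.swap r.castSucc (Fin.last m) i))
      (measurable_pi_lambda _ fun i => measurable_pi_apply _)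
      (fun F => integral_pi_swap _ _ F) (fun x => by ext i; simp) hSi (hev _) (hev _)
      (fun x => hSh _) (fun x => by simp) (fun x => ?_)
      (fun p => integral_trace_mul_eq_zero (G := fun x => S x ^ p) hY hY0 (hS.pow p))
      (fun p => integral_trace_mul_eq_zero (G := fun x => S x ^ p * Y (x r)) hY hY0
        ((hS.pow p).mul hYr))
      (fun p => integral_trace_mul_eq_zero (G := fun x => Y (x r) * S x ^ p) hY hY0
        (hYr.mul (hS.pow p)))
      (fun x => hYsq _) (fun x => hYsq _) k
    rw [← hSx, ← hSx, ← Finset.sum_sub_distrib, Finset.sum_eq_single r]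
    · simp
    · intro i _ hi
      beta_reduce
      rw [Equiv.swap_apply_of_ne_of_ne (fun h => hi (Fin.castSucc_injective _ h))
        (Fin.castSucc_lt_last i).ne, sub_self]
    · simp
  -- summation over the summands
  have h0 : ∀ p, ∫ x, (S x ^ p).trace.re ∂(Measure.pi fun _ : Fin m => μ) =
      ∫ x, ((S fun r => x r.castSucc) ^ p).trace.re ∂P := fun p =>
    (integral_pi_castSucc
      (Complex.measurable_re.comp (hS.pow p).measurable_trace).aestronglyMeasurable).symm
  have hsum : ∀ p, ∫ x, (S x ^ (p + 1)).trace.re ∂(Measure.pi fun _ : Fin m => μ) =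
      ∑ r : Fin m, ∫ x, (Y (x r.castSucc) * (S fun r => x r.castSucc) ^ p).trace.re ∂P := by
    intro p
    rw [h0, ← integral_finsetSum _
      (by exact fun r _ => ((hev _).mul (hSi.pow _)).integrable_trace.re)]
    refine integral_congr_ae (.of_forall fun x => ?_)
    have : (S fun r => x r.castSucc) ^ (p + 1) =
        ∑ r : Fin m, Y (x r.castSucc) * (S fun r => x r.castSucc) ^ p := by
      rw [pow_succ', ← Matrix.sum_mul, hSx fun r => x r.castSucc]
    beta_reduce
    rw [this, Matrix.trace_sum, Complex.re_sum]
  rw [show 2 * k + 2 = 2 * k + 1 + 1 from rfl, hsum, hsum, h0]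
  refine (Finset.sum_le_sum fun r _ => key r).trans_eq ?_
  rw [← Finset.mul_sum, Finset.sum_add_distrib, ← Finset.mul_sum, Finset.sum_const,
    Finset.card_univ, Fintype.card_fin, nsmul_eq_mul]
  ring

end MomentRecursion

/-! ### The tail bound -/

section Tail

variable {n : Type*} [Fintype n] [DecidableEq n] {X : Type*} [MeasurableSpace X]
  {μ : Measure X} [IsProbabilityMeasure μ] {m : ℕ}

lemma two_mul_add_one_mul_pow_self_le (j : ℕ) :
    ((2 * j + 1 : ℝ)) * (j : ℝ) ^ j ≤ ((j : ℝ) + 1) ^ (j + 1) := by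
  rcases Nat.eq_zero_or_pos j with rfl | hj
  · simp
  have hj' : (0 : ℝ) < j := by exact_mod_cast hj
  have h := one_add_mul_le_pow (a := 1 / (j : ℝ)) (by
    have : 0 ≤ 1 / (j : ℝ) := by positivity
    linarith) (j + 1)
  have e : ((j : ℝ) + 1) ^ (j + 1) = (1 + 1 / (j : ℝ)) ^ (j + 1) * (j : ℝ) ^ (j + 1) := by
    rw [← mul_pow]
    congr 1
    field_simp
  rw [e]
  calc _ = (1 + ((j + 1 : ℕ) : ℝ) * (1 / (j : ℝ))) * (j : ℝ) ^ (j + 1) := by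
        push_cast
        field_simp
        ring
    _ ≤ _ := mul_le_mul_of_nonneg_right h (by positivity)

/-- Bound for the even trace moments of a sum of `m` independent centered matrices satisfying a
quadratic equation with coefficients of size at most `K`, for orders small compared with `m / K`.
The factor `j ^ j` comes from `1 * 3 * ⋯ * (2 * j - 1)`. -/
lemma integral_trace_even_pow_le {Y : X → Matrix n n ℂ} (hY : IsBddMeas Y)
    (hYh : ∀ y, (Y y).IsHermitian) (hY0 : ∀ i j, ∫ y, Y y i j ∂μ = 0) {a b K : ℝ}
    (hYsq : ∀ y, Y y ^ 2 = (a : ℂ) • Y y + (b : ℂ) • 1) (ha : |a| ≤ K) (hb : b ≤ K)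
    (hm : 0 < m) {p : ℕ} (hp : (2 * p - 1) * K * 5 ≤ 2 * m) (j : ℕ) (hj : j ≤ p) :
    ∫ x, ((∑ r, Y (x r)) ^ (2 * j)).trace.re ∂(Measure.pi fun _ : Fin m => μ) ≤
      Fintype.card n * ((45 / 32 * (m * K)) ^ j * (j : ℝ) ^ j) := by
  have hK : 0 ≤ K := (abs_nonneg a).trans ha
  have hm' : (0 : ℝ) < m := by exact_mod_cast hm
  have hSh : ∀ x : Fin m → X, (∑ r, Y (x r)).IsHermitian := fun x =>
    isSelfAdjoint_sum _ fun r _ => (hYh (x r) : IsSelfAdjoint _)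
  have hS : IsBddMeas fun x : Fin m → X => ∑ r, Y (x r) :=
    IsBddMeas.sum fun r => hY.comp (measurable_pi_apply r)
  induction j with
  | zero => simp
  | succ j ih =>
    specialize ih (by omega)
    have hrec := integral_trace_even_pow_succ_le (m := m) hY hYh hY0 hYsq j
    have hi : ∀ q, Integrable (fun x : Fin m → X => ((∑ r, Y (x r)) ^ q).trace.re)
        (Measure.pi fun _ : Fin m => μ) := fun q => (hS.pow q).integrable_trace.re
    set M := ∫ x, ((∑ r, Y (x r)) ^ (2 * j)).trace.re ∂(Measure.pi fun _ : Fin m => μ) with hM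
    set N := ∫ x, ((∑ r, Y (x r)) ^ (2 * j + 1)).trace.re ∂(Measure.pi fun _ : Fin m => μ)
      with hN
    rw [show 2 * (j + 1) = 2 * j + 2 by ring]
    set M' := ∫ x, ((∑ r, Y (x r)) ^ (2 * j + 2)).trace.re ∂(Measure.pi fun _ : Fin m => μ)
      with hM'
    have hM0 : 0 ≤ M := integral_nonneg fun x => trace_even_pow_nonneg (hSh x) j
    have hM'0 : 0 ≤ M' := integral_nonneg fun x => trace_even_pow_nonneg (hSh x) (j + 1)
    -- the weight `m / 2` leaves a coefficient of at most `1 / 5` in front of `M'` below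
    have hNle : |N| ≤ (((m : ℝ) / 2)⁻¹ * M' + (m : ℝ) / 2 * M) / 2 := by
      refine (abs_integral_le_integral_abs).trans ?_
      rw [hM, hM', ← integral_const_mul, ← integral_const_mul, ← integral_add
        ((hi _).const_mul _) ((hi _).const_mul _), ← integral_div]
      exact integral_mono (hi _).abs ((((hi _).const_mul _).add ((hi _).const_mul _)).div_const _)
        fun x => abs_trace_odd_pow_le (hSh x) j (by positivity)
    have haN : a * N ≤ K * ((((m : ℝ) / 2)⁻¹ * M' + (m : ℝ) / 2 * M) / 2) := by
      refine (le_abs_self _).trans ?_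
      rw [abs_mul]
      exact mul_le_mul ha hNle (abs_nonneg _) hK
    have hbM : 2 * m * b * M ≤ 2 * m * K * M := by gcongr
    have hj1 : (2 * (j : ℝ) + 1) * K * 5 ≤ 2 * m := by
      refine le_trans ?_ hp
      have : ((j + 1 : ℕ) : ℝ) ≤ p := by exact_mod_cast hj
      push_cast at this
      gcongr
      linarith
    have hstep : M' ≤ (2 * j + 1) * (45 / 32 * (m * K)) * M := by
      have h1 : M' ≤ (2 * j + 1) / 2 * (K / m * M' + 9 / 4 * (m * K) * M) := by
        refine hrec.trans (mul_le_mul_of_nonneg_left ?_ (by positivity))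
        refine (add_le_add haN hbM).trans_eq ?_
        field_simp
        ring
      have h2 : (2 * j + 1) / 2 * (K / m * M') ≤ 1 / 5 * M' := by
        rw [← mul_assoc]
        refine mul_le_mul_of_nonneg_right ?_ hM'0
        rw [div_mul_div_comm, div_le_div_iff₀ (by positivity) (by norm_num)]
        linarith
      linarith
    have hpow := two_mul_add_one_mul_pow_self_le j
    calc M' ≤ (2 * j + 1) * (45 / 32 * (m * K)) * M := hstep
      _ ≤ (2 * j + 1) * (45 / 32 * (m * K)) *
          (Fintype.card n * ((45 / 32 * (m * K)) ^ j * (j : ℝ) ^ j)) := by gcongr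
      _ = Fintype.card n * ((45 / 32 * (m * K)) ^ (j + 1) * ((2 * j + 1) * (j : ℝ) ^ j)) := by
        ring
      _ ≤ Fintype.card n * ((45 / 32 * (m * K)) ^ (j + 1) * ((j + 1 : ℕ) : ℝ) ^ (j + 1)) := by
        push_cast
        gcongr

/-- The sum of `m` independent centered matrices exceeds `α m` in Schatten `2p`-norm with
probability at most `ε`, for `p` about `log (2 * K / ε)`, where `K` is the dimension. -/
lemma exists_measure_trace_pow_gt_le [Nonempty n] {Y : X → Matrix n n ℂ} (hY : IsBddMeas Y)
    (hYh : ∀ y, (Y y).IsHermitian) (hY0 : ∀ i j, ∫ y, Y y i j ∂μ = 0) {a b : ℝ}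
    (hYsq : ∀ y, Y y ^ 2 = (a : ℂ) • Y y + (b : ℂ) • 1) (ha : |a| ≤ Fintype.card n)
    (hb : b ≤ Fintype.card n) {α ε : ℝ} (hα0 : 0 < α) (hα1 : α < 1) (hε : 0 < ε) (hε1 : ε < 1)
    (hm : 10 / α ^ 2 * (Fintype.card n : ℝ) * Real.log (2 * (Fintype.card n : ℝ) / ε) ≤ m) :
    ∃ p ≠ 0, (Measure.pi fun _ : Fin m => μ)
      {x | (α * m) ^ (2 * p) < ((∑ r, Y (x r)) ^ (2 * p)).trace.re} ≤ ENNReal.ofReal ε := by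
  set K : ℝ := (Fintype.card n : ℝ) with hKdef
  have hK1 : 1 ≤ K := by
    rw [hKdef]
    exact_mod_cast Fintype.card_pos
  have hK0 : 0 < K := by linarith
  set L := Real.log (2 * K / ε) with hL
  have hLlb : 0.69 ≤ L := by
    have h2 : Real.log 2 ≤ L := by
      refine Real.log_le_log (by norm_num) ?_
      rw [le_div_iff₀ hε]
      nlinarith
    have := Real.log_two_gt_d9
    linarith
  have hL0 : 0 < L := by linarith
  have hKL : 10 * (K * L) ≤ α ^ 2 * m := by
    have : 10 / α ^ 2 * K * L = 10 * (K * L) / α ^ 2 := by ring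
    rw [this, div_le_iff₀ (by positivity)] at hm
    linarith
  have hmpos : (0 : ℝ) < m := by
    have : 0 < K * L := by positivity
    by_contra h
    have : α ^ 2 * (m : ℝ) ≤ 0 := mul_nonpos_of_nonneg_of_nonpos (by positivity) (not_lt.1 h)
    linarith
  -- the smallest order with `K * exp (-p) ≤ ε / 2`
  set p := ⌈L⌉₊ with hp
  have hp0 : p ≠ 0 := (Nat.ceil_pos.2 hL0).ne'
  have hpL : L ≤ p := Nat.le_ceil L
  have hpL' : (p : ℝ) < L + 1 := Nat.ceil_lt_add_one hL0.le
  refine ⟨p, hp0, ?_⟩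
  have hcond : (2 * p - 1) * K * 5 ≤ 2 * m := by
    have h1 : (2 * (p : ℝ) - 1) ≤ 4 * L := by linarith
    have h2 : (2 * (p : ℝ) - 1) * K * 5 ≤ 4 * L * K * 5 := by gcongr
    have h3 : α ^ 2 * m ≤ 1 * m := by
      gcongr
      nlinarith
    linarith
  have hmom := integral_trace_even_pow_le hY hYh hY0 hYsq ha hb (by exact_mod_cast hmpos)
    hcond p le_rfl
  have hratio : 45 / 32 * (m * K) * p ≤ Real.exp (-1) * (α * m) ^ 2 := by
    -- rounding up costs at most the factor `1 + 1 / 0.69 < 2.45`, and `45 / 320 * 2.45 < exp (-1)`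
    have h1 : (p : ℝ) ≤ 2.45 * L := by linarith
    have h2 : 0.36 ≤ Real.exp (-1) := by
      have := Real.exp_neg_one_gt_d9
      linarith
    calc 45 / 32 * (m * K) * p ≤ 45 / 32 * (m * K) * (2.45 * L) := by gcongr
      _ = (45 / 32 * 2.45 / 10) * m * (10 * (K * L)) := by ring
      _ ≤ (45 / 32 * 2.45 / 10) * m * (α ^ 2 * m) := by gcongr
      _ = (45 / 32 * 2.45 / 10) * (α * m) ^ 2 := by ring
      _ ≤ Real.exp (-1) * (α * m) ^ 2 := by
        gcongr
        linarith
  have hle : ∫ x, ((∑ r, Y (x r)) ^ (2 * p)).trace.re ∂(Measure.pi fun _ : Fin m => μ) ≤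
      ε * (α * m) ^ (2 * p) := by
    refine hmom.trans ?_
    rw [← hKdef, ← mul_pow]
    calc K * (45 / 32 * (m * K) * p) ^ p ≤ K * (Real.exp (-1) * (α * m) ^ 2) ^ p := by gcongr
      _ = K * Real.exp (-p) * (α * m) ^ (2 * p) := by
        rw [mul_pow, ← pow_mul, ← Real.exp_nat_mul]
        ring_nf
      _ ≤ K * Real.exp (-L) * (α * m) ^ (2 * p) := by gcongr
      _ = ε / 2 * (α * m) ^ (2 * p) := by
        rw [Real.exp_neg, hL, Real.exp_log (by positivity)]
        field_simp
      _ ≤ ε * (α * m) ^ (2 * p) := by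
        gcongr
        linarith
  have hSh : ∀ x : Fin m → X, (∑ r, Y (x r)).IsHermitian := fun x =>
    isSelfAdjoint_sum _ fun r _ => (hYh (x r) : IsSelfAdjoint _)
  have hS : IsBddMeas fun x : Fin m → X => ∑ r, Y (x r) :=
    IsBddMeas.sum fun r => hY.comp (measurable_pi_apply r)
  have hmarkov := mul_meas_ge_le_integral_of_nonneg
    (μ := Measure.pi fun _ : Fin m => μ)
    (f := fun x => ((∑ r, Y (x r)) ^ (2 * p)).trace.re)
    (.of_forall fun x => trace_even_pow_nonneg (hSh x) p) (hS.pow _).integrable_trace.re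
    ((α * m) ^ (2 * p))
  have ht : 0 < (α * m) ^ (2 * p) := by positivity
  have hreal : (Measure.pi fun _ : Fin m => μ).real
      {x | (α * m) ^ (2 * p) ≤ ((∑ r, Y (x r)) ^ (2 * p)).trace.re} ≤ ε := by
    have := hmarkov.trans hle
    rw [mul_comm] at this
    exact le_of_mul_le_mul_right this ht
  have hsub : {x : Fin m → X | (α * m) ^ (2 * p) < ((∑ r, Y (x r)) ^ (2 * p)).trace.re} ⊆
      {x | (α * m) ^ (2 * p) ≤ ((∑ r, Y (x r)) ^ (2 * p)).trace.re} :=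
    Set.ofPred_subset_ofPred.2 fun x hx => hx.le
  refine (measure_mono hsub).trans ?_
  rw [← ofReal_measureReal]
  exact ENNReal.ofReal_le_ofReal hreal

end Tail

/-! ### Integration over unions of unit cubes -/

section Cubes

variable {d k : ℕ}

/-- The half-open unit cube `(-1/2, 1/2]^d`. Its integer translates are disjoint. -/
def halfOpenCube (d : ℕ) : Set (EuclideanSpace ℝ (Fin d)) :=
  {x | ∀ i, x i ∈ Set.Ioc (-(1 / 2) : ℝ) (-(1 / 2) + 1)}

lemma halfOpenCube_eq_preimage : halfOpenCube d =
    WithLp.ofLp ⁻¹' Set.univ.pi fun _ => Set.Ioc (-(1 / 2) : ℝ) (-(1 / 2) + 1) := by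
  ext x
  simp [halfOpenCube]

lemma measurableSet_halfOpenCube : MeasurableSet (halfOpenCube d) := by
  rw [halfOpenCube_eq_preimage]
  exact (PiLp.volume_preserving_ofLp (Fin d)).measurable
    (MeasurableSet.univ_pi fun _ => measurableSet_Ioc)

lemma halfOpenCube_ae_eq_unitCube : halfOpenCube d =ᵐ[volume] unitCube d := by
  have h := (PiLp.volume_preserving_ofLp (Fin d)).quasiMeasurePreserving.preimage_ae_eq
    (Measure.univ_pi_Ioc_ae_eq_Icc (μ := fun _ : Fin d => (volume : Measure ℝ))
      (f := fun _ => -(1 / 2)) (g := fun _ => -(1 / 2) + 1))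
  have e2 : unitCube d =
      WithLp.ofLp ⁻¹' Set.Icc (fun _ => -(1 / 2) : Fin d → ℝ) (fun _ => -(1 / 2) + 1) := by
    ext x
    simp only [unitCube, Set.mem_ofPred_eq, Set.mem_preimage, Set.mem_Icc, Pi.le_def]
    rw [← forall_and]
    norm_num
  rw [halfOpenCube_eq_preimage, e2]
  exact h

lemma volume_halfOpenCube : volume (halfOpenCube d) = 1 := by
  have h := (PiLp.volume_preserving_ofLp (Fin d)).measure_preimage
    (MeasurableSet.univ_pi fun _ : Fin d =>
      measurableSet_Ioc (a := (-(1 / 2) : ℝ)) (b := -(1 / 2) + 1)).nullMeasurableSet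
  rw [volume_pi_pi] at h
  rw [halfOpenCube_eq_preimage, h]
  simp

lemma volume_unitCube : volume (unitCube d) = 1 := by
  rw [← measure_congr halfOpenCube_ae_eq_unitCube, volume_halfOpenCube]

lemma disjoint_translate_halfOpenCube {a b : Fin d → ℤ} (hab : a ≠ b) :
    Disjoint ((fun y => y - intPoint a) ⁻¹' halfOpenCube d)
      ((fun y => y - intPoint b) ⁻¹' halfOpenCube d) := by
  rw [Set.disjoint_left]
  intro y ha hb
  refine hab (funext fun i => ?_)
  have h1 := ha i
  have h2 := hb i
  simp only [intPoint, PiLp.sub_apply, Set.mem_Ioc] at h1 h2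
  have h3 : (a i : ℝ) < b i + 1 := by linarith
  have h4 : (b i : ℝ) < a i + 1 := by linarith
  norm_cast at h3 h4
  omega

lemma cubeUnion_ae_eq (ℓ : Fin k → Fin d → ℤ) :
    cubeUnion ℓ =ᵐ[volume] ⋃ i, (fun y => y - intPoint (ℓ i)) ⁻¹' halfOpenCube d := by
  refine Filter.EventuallyEq.countable_iUnion fun i => ?_
  have h : (fun y => y + intPoint (ℓ i)) '' unitCube d =
      (fun y => y - intPoint (ℓ i)) ⁻¹' unitCube d := by
    ext y
    simp only [Set.mem_image, Set.mem_preimage]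
    constructor
    · rintro ⟨z, hz, rfl⟩; simpa using hz
    · intro hy; exact ⟨_, hy, by simp⟩
  rw [h]
  exact ((measurePreserving_sub_right volume _).quasiMeasurePreserving.preimage_ae_eq
    halfOpenCube_ae_eq_unitCube).symm

lemma measurePreserving_translate_halfOpenCube (c : EuclideanSpace ℝ (Fin d)) :
    MeasurePreserving (fun y => y + c) (volume.restrict (halfOpenCube d))
      (volume.restrict ((fun y => y - c) ⁻¹' halfOpenCube d)) := by
  have h := (measurePreserving_add_right volume c).restrict_preimage
    ((measurePreserving_sub_right volume c).measurable measurableSet_halfOpenCube)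
  have e : (fun y => y + c) ⁻¹' ((fun y => y - c) ⁻¹' halfOpenCube d) = halfOpenCube d := by
    ext y; simp
  rwa [e] at h

lemma integral_eq_sum_halfOpenCube {G : Type*} [NormedAddCommGroup G] [NormedSpace ℝ G]
    {ℓ : Fin k → Fin d → ℤ} (hℓ : Function.Injective ℓ) {F : EuclideanSpace ℝ (Fin d) → G}
    (hF : Integrable F) (hF0 : ∀ᵐ ω, ω ∉ cubeUnion ℓ → F ω = 0) :
    ∫ ω, F ω = ∑ i, ∫ ω in halfOpenCube d, F (ω + intPoint (ℓ i)) := by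
  rw [← setIntegral_eq_integral_of_ae_compl_eq_zero hF0, setIntegral_congr_set (cubeUnion_ae_eq ℓ),
    integral_iUnion_fintype
      (fun i => (measurePreserving_sub_right volume _).measurable measurableSet_halfOpenCube)
      (fun i j hij => disjoint_translate_halfOpenCube (hℓ.ne hij)) fun i => hF.integrableOn]
  refine Finset.sum_congr rfl fun i _ => ?_
  exact ((measurePreserving_translate_halfOpenCube _).integral_comp
    (measurableEmbedding_addRight _) _).symm

lemma volume_cubeUnion_lt_top (ℓ : Fin k → Fin d → ℤ) : volume (cubeUnion ℓ) < ⊤ := by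
  rw [measure_congr (cubeUnion_ae_eq ℓ)]
  refine (measure_iUnion_le _).trans_lt ?_
  simp only [tsum_fintype]
  refine ENNReal.sum_lt_top.2 fun i _ => ?_
  rw [(measurePreserving_sub_right volume _).measure_preimage
    measurableSet_halfOpenCube.nullMeasurableSet, volume_halfOpenCube]
  exact ENNReal.one_lt_top

end Cubes

/-! ### Fourier series on the unit cube -/

section Parseval

variable {d : ℕ}

local instance : MeasureSpace UnitAddCircle := ⟨AddCircle.haarAddCircle⟩

local instance : IsProbabilityMeasure (volume : Measure UnitAddCircle) :=
  inferInstanceAs (IsProbabilityMeasure AddCircle.haarAddCircle)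

/-- The representative in the half-open unit cube of a point of the torus. -/
def torusToCube (d : ℕ) (t : UnitAddTorus (Fin d)) : EuclideanSpace ℝ (Fin d) :=
  WithLp.toLp 2 (UnitAddTorus.measurableEquivPiIoc (fun _ => -(1 / 2)) t).1

lemma measurePreserving_torusToCube :
    MeasurePreserving (torusToCube d) volume (volume.restrict (halfOpenCube d)) := by
  have hs : MeasurableSet {x : Fin d → ℝ | ∀ i, x i ∈ Set.Ioc (-(1 / 2) : ℝ) (-(1 / 2) + 1)} :=
    MeasurableSet.univ_pi' fun _ => measurableSet_Ioc
  have h1 := UnitAddTorus.measurePreserving_equivPiIoc (d := Fin d) (fun _ => -(1 / 2))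
  have h2 := measurePreserving_subtype_coe (μa := volume) hs
  have h3 := (PiLp.volume_preserving_toLp (Fin d)).restrict_preimage
    (measurableSet_halfOpenCube (d := d))
  exact h3.comp (h2.comp h1)

lemma mFourier_eq_exp_torusToCube (n : Fin d → ℤ) (t : UnitAddTorus (Fin d)) :
    UnitAddTorus.mFourier n t =
      Complex.exp ((2 * Real.pi * inner ℝ (torusToCube d t) (intPoint n) : ℝ) * Complex.I) := by
  have ht : ∀ i, ((torusToCube d t i : ℝ) : UnitAddCircle) = t i := by
    intro i
    exact congrFun ((UnitAddTorus.measurableEquivPiIoc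
      (fun _ : Fin d => (-(1 / 2) : ℝ))).symm_apply_apply t) i
  have : UnitAddTorus.mFourier n t =
      ∏ i, fourier (n i) ((torusToCube d t i : ℝ) : UnitAddCircle) := by
    simp only [ht]; rfl
  rw [this]
  simp only [fourier_coe_apply, ← Complex.exp_sum, PiLp.inner_apply, intPoint]
  congr 1
  simp only [RCLike.inner_apply, conj_trivial]
  push_cast
  rw [Finset.mul_sum, Finset.sum_mul]
  refine Finset.sum_congr rfl fun i _ => ?_
  ring

/-- **Parseval's identity** on the unit cube. -/
lemma hasSum_sq_norm_integral_halfOpenCube {G : EuclideanSpace ℝ (Fin d) → ℂ}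
    (hG : MemLp G 2 (volume.restrict (halfOpenCube d))) :
    HasSum (fun n : Fin d → ℤ => ‖∫ ω in halfOpenCube d,
        Complex.exp ((2 * Real.pi * inner ℝ ω (intPoint n) : ℝ) * Complex.I) * G ω‖ ^ 2)
      (∫ ω in halfOpenCube d, ‖G ω‖ ^ 2) := by
  have hT := measurePreserving_torusToCube (d := d)
  have hg : MemLp (G ∘ torusToCube d) 2 volume := hG.comp_measurePreserving hT
  have h := UnitAddTorus.hasSum_sq_mFourierCoeff hg.toLp
  have hnorm : ∫ t, ‖hg.toLp _ t‖ ^ 2 = ∫ ω in halfOpenCube d, ‖G ω‖ ^ 2 := by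
    rw [← hT.map_eq, integral_map hT.measurable.aemeasurable (by
      rw [hT.map_eq]; exact (hG.aestronglyMeasurable.norm.pow 2))]
    refine integral_congr_ae ?_
    filter_upwards [hg.coeFn_toLp] with t ht
    rw [ht]; rfl
  have hcoeff : ∀ n : Fin d → ℤ, ∫ ω in halfOpenCube d,
      Complex.exp ((2 * Real.pi * inner ℝ ω (intPoint n) : ℝ) * Complex.I) * G ω =
      UnitAddTorus.mFourierCoeff (hg.toLp _) (-n) := by
    intro n
    have hexp : Continuous fun ω : EuclideanSpace ℝ (Fin d) =>
        Complex.exp ((2 * Real.pi * inner ℝ ω (intPoint n) : ℝ) * Complex.I) := by fun_prop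
    rw [← hT.map_eq, integral_map hT.measurable.aemeasurable (by
        rw [hT.map_eq]; exact hexp.aestronglyMeasurable.mul hG.aestronglyMeasurable),
      UnitAddTorus.mFourierCoeff]
    refine integral_congr_ae ?_
    filter_upwards [hg.coeFn_toLp] with t ht
    rw [ht, ← mFourier_eq_exp_torusToCube, neg_neg]
    rfl
  rw [hnorm, ← (Equiv.neg (Fin d → ℤ)).hasSum_iff] at h
  simp only [hcoeff]
  exact h

lemma integral_exp_intPoint (n : Fin d → ℤ) :
    ∫ ω in halfOpenCube d,
        Complex.exp ((2 * Real.pi * inner ℝ ω (intPoint n) : ℝ) * Complex.I) =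
      if n = 0 then 1 else 0 := by
  have hT := measurePreserving_torusToCube (d := d)
  have hexp : Continuous fun ω : EuclideanSpace ℝ (Fin d) =>
      Complex.exp ((2 * Real.pi * inner ℝ ω (intPoint n) : ℝ) * Complex.I) := by fun_prop
  rw [← hT.map_eq, integral_map hT.measurable.aemeasurable hexp.aestronglyMeasurable]
  simp only [← mFourier_eq_exp_torusToCube]
  have h := orthonormal_iff_ite.1 (UnitAddTorus.orthonormal_mFourier (d := Fin d)) 0 n
  rw [ContinuousMap.inner_toLp] at h
  simpa [UnitAddTorus.mFourier_zero, eq_comm] using h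

end Parseval

/-! ### The continuous representative -/

section Representative

variable {V : Type*} [NormedAddCommGroup V] [InnerProductSpace ℝ V] [FiniteDimensional ℝ V]
  [MeasurableSpace V] [BorelSpace V]

lemma continuous_fourierInv_of_integrable {h : V → ℂ} (hh : Integrable h) :
    Continuous (𝓕⁻ h) :=
  VectorFourier.fourierIntegral_continuous Real.continuous_fourierChar
    continuous_inner.neg hh

/-- For an `L²` function with integrable Fourier transform, the inverse Fourier integral of the
transform represents the function. Both sides define the same tempered distribution. -/
lemma fourierInv_fourier_ae_eq (f : Lp ℂ 2 (volume : Measure V))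
    (hf : Integrable (𝓕 f : Lp ℂ 2 (volume : Measure V))) :
    𝓕⁻ (⇑(𝓕 f : Lp ℂ 2 (volume : Measure V))) =ᵐ[volume] f := by
  set h : Lp ℂ 2 (volume : Measure V) := 𝓕 f with hh
  have hfh : 𝓕⁻ h = f := FourierTransform.fourierInv_fourier_eq f
  refine ae_eq_of_integral_contDiff_smul_eq
    (continuous_fourierInv_of_integrable hf).locallyIntegrable
    ((Lp.memLp f).locallyIntegrable (by norm_num)) fun g hg hgc => ?_
  have hgc' : HasCompactSupport (fun x => (g x : ℂ)) := hgc.comp_left Complex.ofReal_zero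
  set φ : SchwartzMap V ℂ := hgc'.toSchwartzMap (Complex.ofRealCLM.contDiff.comp hg) with hφ
  have hφg : ∀ x, φ x = (g x : ℂ) := fun x => rfl
  have h1 := Lp.fourierInv_toTemperedDistribution_eq h
  have h2 := congrArg (fun u : TemperedDistribution V ℂ => u φ) h1
  simp only [TemperedDistribution.fourierInv_apply, Lp.toTemperedDistribution_apply, hfh] at h2
  have h3 := VectorFourier.integral_fourierIntegral_smul_eq_flip (μ := (volume : Measure V))
    (ν := (volume : Measure V)) (L := -innerₗ V) Real.continuous_fourierChar continuous_inner.neg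
    φ.integrable hf
  -- the kernel of the inverse transform is symmetric
  have hflip : (-innerₗ V).flip = -innerₗ V := by
    ext x y; simp [real_inner_comm]
  rw [hflip] at h3
  have h4 : ∫ x, (𝓕⁻ φ : SchwartzMap V ℂ) x • h x = ∫ x, φ x • (𝓕⁻ (⇑h)) x := by
    rw [SchwartzMap.fourierInv_coe]
    exact h3
  rw [h4] at h2
  simpa [hφg] using h2

end Representative

/-! ### The random matrices -/

section SampleMatrix

variable {d k : ℕ}

/-- The character `x ↦ exp (2πi ⟨x, n⟩)`. -/
def latticeChar (n : Fin d → ℤ) (x : EuclideanSpace ℝ (Fin d)) : ℂ :=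
  Complex.exp ((2 * Real.pi * inner ℝ x (intPoint n) : ℝ) * Complex.I)

lemma continuous_latticeChar (n : Fin d → ℤ) : Continuous (latticeChar n) := by
  unfold latticeChar
  fun_prop

lemma norm_latticeChar (n : Fin d → ℤ) (x : EuclideanSpace ℝ (Fin d)) :
    ‖latticeChar n x‖ = 1 := Complex.norm_exp_ofReal_mul_I _

lemma star_latticeChar_mul (a b : Fin d → ℤ) (x : EuclideanSpace ℝ (Fin d)) :
    star (latticeChar a x) * latticeChar b x = latticeChar (b - a) x := by
  have : intPoint (b - a) = intPoint b - intPoint a := by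
    ext i; simp [intPoint]
  simp only [latticeChar, RCLike.star_def]
  rw [← Complex.exp_conj, ← Complex.exp_add, this, inner_sub_right]
  simp only [map_mul, Complex.conj_ofReal, Complex.conj_I]
  congr 1
  push_cast
  ring

/-- The deviation from the identity of the rank one Gram matrix
`(conj (c i) * c j)`, where `c i = exp (2πi ⟨x, ℓ i⟩)`. -/
def sampleMatrix (ℓ : Fin k → Fin d → ℤ) (x : EuclideanSpace ℝ (Fin d)) :
    Matrix (Fin k) (Fin k) ℂ :=
  Matrix.vecMulVec (star fun i => latticeChar (ℓ i) x) (fun i => latticeChar (ℓ i) x) - 1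

lemma sampleMatrix_apply (ℓ : Fin k → Fin d → ℤ) (x : EuclideanSpace ℝ (Fin d)) (i j : Fin k) :
    sampleMatrix ℓ x i j = latticeChar (ℓ j - ℓ i) x - (1 : Matrix (Fin k) (Fin k) ℂ) i j := by
  rw [sampleMatrix, Matrix.sub_apply, Matrix.vecMulVec_apply, ← star_latticeChar_mul]
  rfl

lemma isHermitian_sampleMatrix (ℓ : Fin k → Fin d → ℤ) (x : EuclideanSpace ℝ (Fin d)) :
    (sampleMatrix ℓ x).IsHermitian := by
  refine Matrix.IsHermitian.sub ?_ Matrix.isHermitian_one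
  rw [Matrix.IsHermitian, Matrix.conjTranspose_vecMulVec, star_star]

lemma isBddMeas_sampleMatrix (ℓ : Fin k → Fin d → ℤ) : IsBddMeas (sampleMatrix ℓ) := by
  intro i j
  simp only [sampleMatrix_apply]
  refine ⟨((continuous_latticeChar _).sub continuous_const).measurable,
    1 + ‖(1 : Matrix (Fin k) (Fin k) ℂ) i j‖, fun x => (norm_sub_le _ _).trans ?_⟩
  rw [norm_latticeChar]

lemma sampleMatrix_sq (ℓ : Fin k → Fin d → ℤ) (x : EuclideanSpace ℝ (Fin d)) :
    sampleMatrix ℓ x ^ 2 = (((k : ℝ) - 2 : ℝ) : ℂ) • sampleMatrix ℓ x +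
      (((k : ℝ) - 1 : ℝ) : ℂ) • (1 : Matrix (Fin k) (Fin k) ℂ) := by
  set c : Fin k → ℂ := fun i => latticeChar (ℓ i) x with hc
  have hcc : c ⬝ᵥ star c = (k : ℂ) := by
    simp [dotProduct, hc, Complex.mul_conj', norm_latticeChar]
  have hW : Matrix.vecMulVec (star c) c * Matrix.vecMulVec (star c) c =
      (k : ℂ) • Matrix.vecMulVec (star c) c := by
    rw [Matrix.vecMulVec_mul_vecMulVec, hcc, Matrix.vecMulVec_smul]
  rw [sampleMatrix, ← hc, pow_two, Matrix.sub_mul, Matrix.mul_sub, hW]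
  simp only [Matrix.mul_one, Matrix.one_mul]
  push_cast
  module

lemma cond_unitCube_eq :
    (volume : Measure (EuclideanSpace ℝ (Fin d)))[|unitCube d] =
      volume.restrict (halfOpenCube d) := by
  rw [ProbabilityTheory.cond, volume_unitCube, inv_one, one_smul,
    Measure.restrict_congr_set halfOpenCube_ae_eq_unitCube]

instance isProbabilityMeasure_restrict_halfOpenCube :
    IsProbabilityMeasure
      ((volume : Measure (EuclideanSpace ℝ (Fin d))).restrict (halfOpenCube d)) :=
  ⟨by rw [Measure.restrict_apply_univ, volume_halfOpenCube]⟩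

lemma integral_sampleMatrix {ℓ : Fin k → Fin d → ℤ} (hℓ : Function.Injective ℓ) (i j : Fin k) :
    ∫ x in halfOpenCube d, sampleMatrix ℓ x i j = 0 := by
  simp only [sampleMatrix_apply]
  have hint : Integrable (latticeChar (ℓ j - ℓ i)) (volume.restrict (halfOpenCube d)) :=
    .of_bound (continuous_latticeChar _).aestronglyMeasurable 1
      (.of_forall fun x => (norm_latticeChar _ x).le)
  rw [integral_sub hint (integrable_const _), integral_const, probReal_univ, one_smul]
  have := integral_exp_intPoint (ℓ j - ℓ i)
  change ∫ x in halfOpenCube d, latticeChar (ℓ j - ℓ i) x = _ at this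
  rw [this, Matrix.one_apply, sub_eq_zero]
  simp only [sub_eq_zero, hℓ.eq_iff, eq_comm]

lemma norm_sq_sum_latticeChar_mul (ℓ : Fin k → Fin d → ℤ) (x : EuclideanSpace ℝ (Fin d))
    (v : Fin k → ℂ) :
    ‖∑ i, latticeChar (ℓ i) x * v i‖ ^ 2 =
      (star v ⬝ᵥ (sampleMatrix ℓ x).mulVec v).re + ∑ i, ‖v i‖ ^ 2 := by
  set c : Fin k → ℂ := fun i => latticeChar (ℓ i) x with hc
  have h1 : star v ⬝ᵥ v = ((∑ i, ‖v i‖ ^ 2 : ℝ) : ℂ) := by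
    simp only [dotProduct, Pi.star_apply, RCLike.star_def]
    push_cast
    exact Finset.sum_congr rfl fun i _ => Complex.conj_mul' _
  have h2 : star v ⬝ᵥ (Matrix.vecMulVec (star c) c).mulVec v =
      ((‖c ⬝ᵥ v‖ ^ 2 : ℝ) : ℂ) := by
    rw [Matrix.vecMulVec_mulVec, dotProduct_smul, Matrix.star_dotProduct_star,
      MulOpposite.smul_eq_mul_unop, MulOpposite.unop_op, RCLike.star_def, Complex.conj_mul']
    push_cast
    rfl
  rw [sampleMatrix, ← hc, Matrix.sub_mulVec, Matrix.one_mulVec, dotProduct_sub, h1, h2,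
    Complex.sub_re, Complex.ofReal_re, Complex.ofReal_re, sub_add_cancel]
  rfl

/-- With probability at least `1 - ε`, the empirical Gram matrix of the characters is within `α`
of the identity. -/
lemma exists_event_quadraticForm_le {m : ℕ} (ℓ : Fin k → Fin d → ℤ) (hℓ : Function.Injective ℓ)
    {α ε : ℝ} (hα0 : 0 < α) (hα1 : α < 1) (hε : 0 < ε)
    (hm : 10 / α ^ 2 * (k : ℝ) * Real.log (2 * (k : ℝ) / ε) ≤ (m : ℝ))
    {S : Type*} [MeasurableSpace S] (P : Measure S) [IsProbabilityMeasure P]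
    (x : Fin m → S → EuclideanSpace ℝ (Fin d)) (hx : ∀ r, Measurable (x r))
    (hindep : iIndepFun x P)
    (hunif : ∀ r, pdf.IsUniform (x r) (unitCube d) P volume) :
    ∃ A : Set S, MeasurableSet A ∧ ENNReal.ofReal (1 - ε) ≤ P A ∧
      ∀ s ∈ A, ∀ v : Fin k → ℂ,
        |(star v ⬝ᵥ (∑ r, sampleMatrix ℓ (x r s)).mulVec v).re| ≤ α * m * ∑ i, ‖v i‖ ^ 2 := by
  rcases Nat.eq_zero_or_pos k with rfl | hk
  -- without frequencies the quadratic form is an empty sum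
  · refine ⟨Set.univ, .univ, ?_, fun s _ v => by simp⟩
    rw [measure_univ]
    exact ENNReal.ofReal_le_one.2 (by linarith)
  rcases le_or_gt 1 ε with hε1 | hε1
  · refine ⟨∅, .empty, ?_, fun s hs => hs.elim⟩
    rw [ENNReal.ofReal_of_nonpos (by linarith)]
    exact zero_le
  have : Nonempty (Fin k) := ⟨⟨0, hk⟩⟩
  have hk1 : (1 : ℝ) ≤ k := by exact_mod_cast hk
  obtain ⟨p, hp0, hp⟩ := exists_measure_trace_pow_gt_le (m := m) (isBddMeas_sampleMatrix ℓ)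
    (isHermitian_sampleMatrix ℓ) (integral_sampleMatrix hℓ) (sampleMatrix_sq ℓ)
    (by rw [Fintype.card_fin, abs_le]; constructor <;> linarith)
    (by rw [Fintype.card_fin]; linarith) hα0 hα1 hε hε1 (by rwa [Fintype.card_fin])
  have hlaw : P.map (fun s r => x r s) =
      Measure.pi fun _ : Fin m => volume.restrict (halfOpenCube d) := by
    rw [(iIndepFun_iff_map_fun_eq_pi_map fun r => (hx r).aemeasurable).1 hindep]
    congr 1
    ext1 r
    rw [← cond_unitCube_eq]
    exact hunif r
  have hxm : Measurable fun s r => x r s := measurable_pi_lambda _ hx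
  have hB : IsBddMeas fun y : Fin m → EuclideanSpace ℝ (Fin d) => ∑ r, sampleMatrix ℓ (y r) :=
    IsBddMeas.sum fun r => (isBddMeas_sampleMatrix ℓ).comp (measurable_pi_apply r)
  have hBmeas : MeasurableSet {y : Fin m → EuclideanSpace ℝ (Fin d) |
      (α * m) ^ (2 * p) < ((∑ r, sampleMatrix ℓ (y r)) ^ (2 * p)).trace.re} :=
    measurableSet_lt measurable_const (Complex.measurable_re.comp (hB.pow _).measurable_trace)
  rw [← hlaw, Measure.map_apply hxm hBmeas] at hp
  refine ⟨_, (hxm hBmeas).compl, ?_, fun s hs v => ?_⟩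
  · rw [prob_compl_eq_one_sub (hxm hBmeas), ENNReal.ofReal_sub _ hε.le, ENNReal.ofReal_one]
    exact tsub_le_tsub_left hp 1
  · exact abs_re_dotProduct_mulVec_le
      (isSelfAdjoint_sum _ fun r _ => (isHermitian_sampleMatrix ℓ (x r s) : IsSelfAdjoint _))
      hp0 (by positivity) (not_lt.1 hs) v

end SampleMatrix

/-! ### Samples of band-limited functions -/

section Sampling

variable {d k : ℕ} {ℓ : Fin k → Fin d → ℤ}
  {f : Lp ℂ 2 (volume : Measure (EuclideanSpace ℝ (Fin d)))}

lemma integrable_fourier_of_mem_paleyWiener (hf : f ∈ paleyWiener (cubeUnion ℓ)) :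
    Integrable (𝓕 f : Lp ℂ 2 (volume : Measure (EuclideanSpace ℝ (Fin d)))) := by
  have : IsFiniteMeasure (volume.restrict (cubeUnion ℓ)) :=
    ⟨by rw [Measure.restrict_apply_univ]; exact volume_cubeUnion_lt_top ℓ⟩
  have h1 : IntegrableOn (𝓕 f : Lp ℂ 2 (volume : Measure (EuclideanSpace ℝ (Fin d))))
      (cubeUnion ℓ) := ((Lp.memLp _).restrict _).integrable (by norm_num)
  exact h1.integrable_of_ae_notMem_eq_zero hf

lemma isContRep_fourierInv_fourier (hf : f ∈ paleyWiener (cubeUnion ℓ)) :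
    IsContRep f (𝓕⁻ (⇑(𝓕 f : Lp ℂ 2 (volume : Measure (EuclideanSpace ℝ (Fin d)))))) :=
  ⟨continuous_fourierInv_of_integrable (integrable_fourier_of_mem_paleyWiener hf),
    fourierInv_fourier_ae_eq f (integrable_fourier_of_mem_paleyWiener hf)⟩

lemma IsContRep.eq {g g' : EuclideanSpace ℝ (Fin d) → ℂ} (hg : IsContRep f g)
    (hg' : IsContRep f g') : g = g' :=
  (Continuous.ae_eq_iff_eq volume hg.1 hg'.1).1 (hg.2.trans hg'.2.symm)

lemma memLp_fourier_translate (f : Lp ℂ 2 (volume : Measure (EuclideanSpace ℝ (Fin d))))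
    (c : EuclideanSpace ℝ (Fin d)) :
    MemLp (fun ω => (𝓕 f : Lp ℂ 2 (volume : Measure (EuclideanSpace ℝ (Fin d)))) (ω + c)) 2
      (volume.restrict (halfOpenCube d)) :=
  ((Lp.memLp (𝓕 f : Lp ℂ 2 (volume : Measure (EuclideanSpace ℝ (Fin d))))).comp_measurePreserving
    (measurePreserving_add_right volume c)).restrict _

lemma norm_sq_eq_integral_of_mem_paleyWiener (hℓ : Function.Injective ℓ)
    (hf : f ∈ paleyWiener (cubeUnion ℓ)) :
    ‖f‖ ^ 2 = ∫ ω in halfOpenCube d, ∑ i,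
      ‖(𝓕 f : Lp ℂ 2 (volume : Measure (EuclideanSpace ℝ (Fin d)))) (ω + intPoint (ℓ i))‖ ^ 2 := by
  rw [← Lp.norm_fourier_eq, integral_finsetSum _
    fun i _ => (memLp_fourier_translate f _).integrable_norm_pow (by norm_num)]
  set h : Lp ℂ 2 (volume : Measure (EuclideanSpace ℝ (Fin d))) := 𝓕 f with hh
  have h1 : ‖h‖ ^ 2 = ∫ ω, ‖h ω‖ ^ 2 := by
    have h2 := inner_self_eq_norm_sq (𝕜 := ℂ) h
    rw [← h2, L2.inner_def, ← integral_re (L2.integrable_inner h h)]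
    simp only [inner_self_eq_norm_sq]
  rw [h1, integral_eq_sum_halfOpenCube hℓ ((Lp.memLp h).integrable_norm_pow (by norm_num))]
  filter_upwards [hf] with ω hω hω'
  rw [← hh] at hω
  rw [hω hω']
  simp

lemma exp_inner_add_intPoint (a n : Fin d → ℤ) (ω x : EuclideanSpace ℝ (Fin d)) :
    Complex.exp ((2 * Real.pi * inner ℝ (ω + intPoint a) (x + intPoint n) : ℝ) * Complex.I) =
      latticeChar n ω * (Complex.exp ((2 * Real.pi * inner ℝ ω x : ℝ) * Complex.I) *
        latticeChar a x) := by
  have h : inner ℝ (intPoint a) (intPoint n) = ((∑ i, n i * a i : ℤ) : ℝ) := by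
    simp [PiLp.inner_apply, intPoint]
  have h1 :
      Complex.exp ((2 * Real.pi * inner ℝ (intPoint a) (intPoint n) : ℝ) * Complex.I) = 1 := by
    rw [h]
    refine Complex.exp_eq_one_iff.2 ⟨∑ i, n i * a i, ?_⟩
    push_cast
    ring
  rw [inner_add_left, inner_add_right, inner_add_right, real_inner_comm x (intPoint a),
    latticeChar, latticeChar, ← Complex.exp_add, ← Complex.exp_add, ← mul_one (Complex.exp (_ + _)),
    ← h1, ← Complex.exp_add]
  congr 1
  push_cast
  ring

/-- The samples of `f` on `x + ℤ^d` are the Fourier coefficients of a combination of the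
translates to the unit cube of the pieces of the transform of `f`. -/
lemma hasSum_norm_sq_of_isContRep (hℓ : Function.Injective ℓ)
    (hf : f ∈ paleyWiener (cubeUnion ℓ)) {g : EuclideanSpace ℝ (Fin d) → ℂ} (hg : IsContRep f g)
    (x : EuclideanSpace ℝ (Fin d)) :
    HasSum (fun n : Fin d → ℤ => ‖g (x + intPoint n)‖ ^ 2)
      (∫ ω in halfOpenCube d, ‖∑ i, latticeChar (ℓ i) x *
        (𝓕 f : Lp ℂ 2 (volume : Measure (EuclideanSpace ℝ (Fin d))))
          (ω + intPoint (ℓ i))‖ ^ 2) := by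
  rw [hg.eq (isContRep_fourierInv_fourier hf)]
  have hint := integrable_fourier_of_mem_paleyWiener hf
  have hv := fun i => memLp_fourier_translate f (intPoint (ℓ i))
  have hf' : ∀ᵐ ω, ω ∉ cubeUnion ℓ →
    (𝓕 f : Lp ℂ 2 (volume : Measure (EuclideanSpace ℝ (Fin d)))) ω = 0 := hf
  set h : Lp ℂ 2 (volume : Measure (EuclideanSpace ℝ (Fin d))) := 𝓕 f with hh
  let e : EuclideanSpace ℝ (Fin d) → ℂ :=
    fun ω => Complex.exp ((2 * Real.pi * inner ℝ ω x : ℝ) * Complex.I)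
  have hcont : ∀ y : EuclideanSpace ℝ (Fin d), Continuous fun ω : EuclideanSpace ℝ (Fin d) =>
      Complex.exp ((2 * Real.pi * inner ℝ ω y : ℝ) * Complex.I) := fun y => by fun_prop
  have hen : ∀ ω, ‖e ω‖ = 1 := fun ω => Complex.norm_exp_ofReal_mul_I _
  have hsum : MemLp (fun ω => ∑ i, latticeChar (ℓ i) x * h (ω + intPoint (ℓ i))) 2
      (volume.restrict (halfOpenCube d)) := memLp_finsetSum _ fun i _ => (hv i).const_mul _
  have hG : MemLp (fun ω => e ω * ∑ i, latticeChar (ℓ i) x * h (ω + intPoint (ℓ i))) 2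
      (volume.restrict (halfOpenCube d)) := by
    refine hsum.of_le ((hcont x).aestronglyMeasurable.mul hsum.aestronglyMeasurable)
      (.of_forall fun ω => ?_)
    rw [norm_mul, hen, one_mul]
  have hP := hasSum_sq_norm_integral_halfOpenCube hG
  simp only [norm_mul, hen, one_mul] at hP
  convert hP using 4 with n
  rw [Real.fourierInv_eq', integral_eq_sum_halfOpenCube hℓ]
  · rw [← integral_finsetSum]
    · refine integral_congr_ae (.of_forall fun ω => ?_)
      simp only [exp_inner_add_intPoint, Finset.mul_sum, smul_eq_mul]
      refine Finset.sum_congr rfl fun i _ => ?_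
      simp only [latticeChar, e]
      ring
    · intro i _
      refine ((hv i).integrable (by norm_num)).mono ?_ (.of_forall fun ω => ?_)
      · exact ((hcont _).comp (continuous_add_const _)).aestronglyMeasurable.smul
          (hv i).aestronglyMeasurable
      · rw [norm_smul, Complex.norm_exp_ofReal_mul_I, one_mul]
  · refine hint.mono ?_ (.of_forall fun ω => ?_)
    · exact (hcont _).aestronglyMeasurable.smul hint.aestronglyMeasurable
    · rw [norm_smul, Complex.norm_exp_ofReal_mul_I, one_mul]
  · filter_upwards [hf'] with ω hω hω'
    rw [hω hω', smul_zero]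

/-- A bound on the deviation of the empirical Gram matrix from the identity gives the sampling
inequalities for all band-limited functions at once. -/
lemma abs_sum_tsum_sub_le (hℓ : Function.Injective ℓ) {m : ℕ}
    (y : Fin m → EuclideanSpace ℝ (Fin d)) {t : ℝ}
    (hy : ∀ v : Fin k → ℂ,
      |(star v ⬝ᵥ (∑ r, sampleMatrix ℓ (y r)).mulVec v).re| ≤ t * ∑ i, ‖v i‖ ^ 2)
    (hf : f ∈ paleyWiener (cubeUnion ℓ)) {g : EuclideanSpace ℝ (Fin d) → ℂ}
    (hg : IsContRep f g) :
    |∑ r, ∑' n : Fin d → ℤ, ‖g (y r + intPoint n)‖ ^ 2 - m * ‖f‖ ^ 2| ≤ t * ‖f‖ ^ 2 := by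
  simp only [fun r => (hasSum_norm_sq_of_isContRep hℓ hf hg (y r)).tsum_eq,
    norm_sq_eq_integral_of_mem_paleyWiener hℓ hf]
  have hv := fun i => memLp_fourier_translate f (intPoint (ℓ i))
  set h : Lp ℂ 2 (volume : Measure (EuclideanSpace ℝ (Fin d))) := 𝓕 f with hh
  have i1 : ∀ r, Integrable
      (fun ω => ‖∑ i, latticeChar (ℓ i) (y r) * h (ω + intPoint (ℓ i))‖ ^ 2)
      (volume.restrict (halfOpenCube d)) := fun r =>
    (memLp_finsetSum _ fun i _ => (hv i).const_mul _).integrable_norm_pow (by norm_num)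
  have i2 : Integrable (fun ω => ∑ i, ‖h (ω + intPoint (ℓ i))‖ ^ 2)
      (volume.restrict (halfOpenCube d)) :=
    integrable_finsetSum _ fun i _ => (hv i).integrable_norm_pow (by norm_num)
  rw [← integral_finsetSum _ fun r _ => i1 r, ← integral_const_mul, ← integral_const_mul,
    ← integral_sub (integrable_finsetSum _ fun r _ => i1 r) (i2.const_mul _)]
  refine abs_integral_le_integral_abs.trans (integral_mono ?_ (i2.const_mul _) fun ω => ?_)
  · exact ((integrable_finsetSum _ fun r _ => i1 r).sub (i2.const_mul _)).abs
  · have e := hy fun i => h (ω + intPoint (ℓ i))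
    simp only [fun r => norm_sq_sum_latticeChar_mul ℓ (y r) fun i => h (ω + intPoint (ℓ i))]
    rw [Matrix.sum_mulVec, dotProduct_sum, Complex.re_sum] at e
    rw [Finset.sum_add_distrib, Finset.sum_const, Finset.card_univ, Fintype.card_fin,
      nsmul_eq_mul, add_sub_cancel_right]
    exact e

end Sampling

end

theorem corollary2p2 {d k m : ℕ} (ℓ : Fin k → Fin d → ℤ) (hℓ : Function.Injective ℓ)
    {α ε : ℝ} (hα0 : 0 < α) (hα1 : α < 1) (hε : 0 < ε)
    (hm : 10 / α ^ 2 * (k : ℝ) * Real.log (2 * (k : ℝ) / ε) ≤ (m : ℝ))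
    {S : Type*} [MeasurableSpace S] (P : Measure S) [IsProbabilityMeasure P]
    (x : Fin m → S → EuclideanSpace ℝ (Fin d)) (hx : ∀ r, Measurable (x r))
    (hindep : iIndepFun x P)
    (hunif : ∀ r, pdf.IsUniform (x r) (unitCube d) P volume) :
    (∀ f ∈ paleyWiener (cubeUnion ℓ), ∃! g : EuclideanSpace ℝ (Fin d) → ℂ, IsContRep f g) ∧
    ∃ A : Set S, MeasurableSet A ∧ ENNReal.ofReal (1 - ε) ≤ P A ∧
      ∀ s ∈ A, ∀ f ∈ paleyWiener (cubeUnion ℓ), ∀ g, IsContRep f g →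
        (∀ r, Summable fun n : Fin d → ℤ => ‖g (x r s + intPoint n)‖ ^ 2) ∧
        (m : ℝ) * (1 - α) * ‖f‖ ^ 2
          ≤ ∑ r, ∑' n : Fin d → ℤ, ‖g (x r s + intPoint n)‖ ^ 2 ∧
        ∑ r, ∑' n : Fin d → ℤ, ‖g (x r s + intPoint n)‖ ^ 2
          ≤ (m : ℝ) * (1 + α) * ‖f‖ ^ 2 := by
  refine ⟨fun f hf => ⟨_, isContRep_fourierInv_fourier hf, fun g hg =>
    hg.eq (isContRep_fourierInv_fourier hf)⟩, ?_⟩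
  obtain ⟨A, hA, hPA, hform⟩ :=
    exists_event_quadraticForm_le ℓ hℓ hα0 hα1 hε hm P x hx hindep hunif
  refine ⟨A, hA, hPA, fun s hs f hf g hg =>
    ⟨fun r => (hasSum_norm_sq_of_isContRep hℓ hf hg (x r s)).summable, ?_⟩⟩
  have h := abs_le.1 (abs_sum_tsum_sub_le hℓ (fun r => x r s) (hform s hs) hf hg)
  constructor <;> nlinarith [h.1, h.2]
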